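/- Let $\mathcal A=(a_1,\dots,a_N)$ be a collection of $N$ real numbers, not necessarily distinct, with $$\sum_{j} a_j=\sum_{j} a_j^3=0,\qquad \sum_{j} a_j^2=1 ,$$ and let $0<n<N$. Let $(X_1,\dots,X_n)$ be a simple random sample of size $n$ from $\mathcal A$, i.e. $(X_1,\dots,X_n)=(a_{J_1},\dots,a_{J_n})$ in law, where $(J_1,\dots,J_n)$ is uniformly distributed over the $N(N-1)\cdots(N-n+1)$ vectors of $n$ distinct indices in $\{1,\dots,N\}$. Put $W=X_1+\cdots+X_n$, $\sigma=\sqrt{EW^2}$, $\langle k\rangle=\sum_j a_j^k$, and let $\Phi h=Eh(Z)$ with $Z\sim\mathcal N(0,1)$. Define $$\alpha=\frac{n-1}{N(N-n)}-1,\qquad \beta=\frac{-2(n-1)}{N(N-n+1)}+\frac{n-3}{N(N-n)}-\frac1N,$$ $$\gamma=\frac{-2}{N(N-n)(N-n+1)},\qquad \eta=\frac{-N+3}{N(N-n)},$$ $$C_1=\sqrt8\Big(\frac{\sigma^2}{4n^2}+\langle 6\rangle\alpha^2+\beta^2+\gamma^2(n-1)^2+\eta^2\Big)^{1/2},\qquad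 C_2=11\langle4\rangle+\frac{45}{N}.$$ Then for every four times differentiable $h:\mathbb R\to\mathbb R$ whose derivatives of orders $1,2,3,4$ are bounded, with $\|\cdot\|$ the supremum norm, $$|Eh(W/\sigma)-\Phi h|\le \frac{1}{3\sigma}\,C_1\,\|h^{(3)}\|+\frac{1}{8\sigma^2}\,C_2\,\|h^{(4)}\|.$$ Further, let $n=n_k$ and $N=N_k$ be sequences of integers with $0<n_k<N_k$, $n_k\to\infty$ and $n_k/N_k\to f\in(0,1)$. Then $$|Eh(W/\sigma)-\Phi h|\le n^{-1}\big\{B_1\|h^{(3)}\|+B_2\|h^{(4)}\|\big\}(1+o(1)),$$ where $$B_1=\frac{\sqrt8}{3}\Big(\frac{f(1-f)}4+n^2\langle6\rangle+2\Big(\frac f{1-f}\Big)^2\Big)^{1/2}\big(f(1-f)\big)^{-1/2},\qquad B_2=\frac18\big(11\,n\langle4\rangle+45f\big)\big(f(1-f)\big)^{-1},$$ and where the $o(1)$ depends only on the sequences $(n_k)$, $(N_k)$ and on $f$; it is uniform over all collections $\mathcal A$ of size $N_k$ as above and all such $h$. -/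

import Mathlib

open MeasureTheory ProbabilityTheory Filter Topology
open scoped ENNReal

noncomputable section

/-- The law of a simple random sample of size `n`, without replacement, from the population
`a 0, …, a (N - 1)` of `N` not necessarily distinct reals: each of the
`N (N - 1) ⋯ (N - n + 1)` vectors of units without repetition is equally likely. -/
def srsLaw {N : ℕ} (n : ℕ) (a : Fin N → ℝ) : Measure (Fin n → ℝ) :=
  (N.descFactorial n : ℝ≥0∞)⁻¹ • ∑ e : Fin n ↪ Fin N, Measure.dirac (fun i => a (e i))

/-- `σ = √(E W²)` for the (mean zero) sum `W = X₁ + ⋯ + Xₙ` of a simple random sample. -/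
def srsSigma {N : ℕ} (n : ℕ) (a : Fin N → ℝ) : ℝ :=
  √(∫ x, (∑ i, x i) ^ 2 ∂(srsLaw n a))

/-- The power sum `⟨k⟩` of the population. -/
def powerSum {N : ℕ} (a : Fin N → ℝ) (k : ℕ) : ℝ := ∑ j, a j ^ k

/-- The coefficient `α`, as a function of the real numbers `N` and `n`. -/
def srsAlpha (N n : ℝ) : ℝ := (n - 1) / (N * (N - n)) - 1

/-- The coefficient `β`. -/
def srsBeta (N n : ℝ) : ℝ :=
  -2 * (n - 1) / (N * (N - n + 1)) + (n - 3) / (N * (N - n)) - 1 / N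

/-- The coefficient `γ`. -/
def srsGamma (N n : ℝ) : ℝ := -2 / (N * (N - n) * (N - n + 1))

/-- The coefficient `η`. -/
def srsEta (N n : ℝ) : ℝ := (-N + 3) / (N * (N - n))

/-- The constant `C₁(N, n, 𝒜)`. -/
def srsC1 {N : ℕ} (n : ℕ) (a : Fin N → ℝ) : ℝ :=
  √8 * √(srsSigma n a ^ 2 / (4 * (n : ℝ) ^ 2) + powerSum a 6 * srsAlpha N n ^ 2
    + srsBeta N n ^ 2 + srsGamma N n ^ 2 * ((n : ℝ) - 1) ^ 2 + srsEta N n ^ 2)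

/-- The constant `C₂(N, 𝒜)`. -/
def srsC2 {N : ℕ} (a : Fin N → ℝ) : ℝ := 11 * powerSum a 4 + 45 / (N : ℝ)

/-- The constant `B₁`, for the limiting sampling fraction `f`. -/
def srsB1 {N : ℕ} (f : ℝ) (n : ℕ) (a : Fin N → ℝ) : ℝ :=
  √8 / 3 * √(f * (1 - f) / 4 + (n : ℝ) ^ 2 * powerSum a 6 + 2 * (f / (1 - f)) ^ 2)
    / √(f * (1 - f))

/-- The constant `B₂`, for the limiting sampling fraction `f`. -/
def srsB2 {N : ℕ} (f : ℝ) (n : ℕ) (a : Fin N → ℝ) : ℝ :=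
  1 / 8 * (11 * (n : ℝ) * powerSum a 4 + 45 * f) / (f * (1 - f))

/-- `h` is four times differentiable and its derivatives of orders `1, 2, 3, 4` are bounded. -/
structure HasFourBoundedDerivs (h : ℝ → ℝ) : Prop where
  differentiable : ∀ k < 4, Differentiable ℝ (iteratedDeriv k h)
  bounded : ∀ k, 1 ≤ k → k ≤ 4 → ∃ M : ℝ, ∀ x, |iteratedDeriv k h x| ≤ M

/-- The supremum norm `‖g‖` of a bounded function on the line. -/
def supNorm (g : ℝ → ℝ) : ℝ := ⨆ x, |g x|

/-- `|E h(W / σ) - Φ h|`, where `W` is a random variable on a space with probability `P`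
and `Φ h` is the mean of `h` under the standard normal law. -/
def normalError {Ω : Type*} [MeasurableSpace Ω] (P : Measure Ω) (W : Ω → ℝ) (σ : ℝ)
    (h : ℝ → ℝ) : ℝ :=
  |∫ ω, h (W ω / σ) ∂P - ∫ z, h z ∂(gaussianReal 0 1)|

/-- The standing conditions on the population: `∑ a = ∑ a³ = 0` and the normalization
`∑ a² = 1`. -/
structure IsAdmissiblePopulation {N : ℕ} (a : Fin N → ℝ) : Prop where
  sum_eq_zero : ∑ j, a j = 0
  sum_cube_eq_zero : ∑ j, a j ^ 3 = 0
  sum_sq_eq_one : ∑ j, a j ^ 2 = 1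

end

/-! ### Exchangeable pair identity and coupling for `n`-subsets -/

section Combinatorics

open Finset

variable {ι : Type*} [DecidableEq ι]

/-! The proof is Stein's method by zero biasing, with a Gaussian rotation in place of the Stein
equation. Let `W` be the sum over a uniform `n`-subset `S`.

Since `∑ a = 0`, `E W f(W)` is a sum over pairs `i, j` of `(a i - a j)` times differences `f(R + a
i) - f(R + a j)`, where `R` stands for the sum over an `(n - 1)`-set avoiding both indices
(`sum_mul_eq_half_sum_pairs`). Such a set can be produced from `S` by changing few elements
(`sum_coupledMean`). Expanding each difference to second order at `W` gives `E W f(W) = σ² E[f'(W) +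
f''(W) D(S)]` up to a remainder, where the drift `D` is `zeroBiasDrift` (`abs_sum_mul_sub_le`).

The drift is explicit: `∑ a = ∑ a³ = 0` reduces it to `-∑_S a³ - c W` with `0 ≤ c ≤ max(1/n, 1/(N -
n))`. The variance formula for subset sums of `a` and of `a³` then bounds `E D²` by `C₁²`
(`sum_zeroBiasDrift_sq_le_srsC1`). The mean squared displacement is at most `⟨4⟩ + 5/N ≤ C₂`.

For the normal comparison, differentiate `θ ↦ E h(sin θ · W/σ + cos θ · Z)` from `θ = 0` (`Z`) to
`π/2` (`W/σ`). Gaussian integration by parts turns the derivative into a zero bias discrepancy for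
`w ↦ h'(sin θ · w/σ + cos θ · z)`, so it is bounded by `cos θ (sin² θ · C₁‖h⁽³⁾‖/σ + sin³ θ ·
C₂‖h⁽⁴⁾‖/(2σ²))`. Its integral gives the constants `1/3` and `1/8` (`abs_average_sub_integral_le`).

The asymptotic bound compares `n` times the two coefficients with `B₁` and `B₂`, through ratios that
depend only on `N`, `n`, `f` and tend to `1`. -/

theorem sum_powersetCard_succ_sum_erase (T : Finset ι) (k : ℕ) (G : Finset ι → ι → ℝ) :
    ∑ S ∈ T.powersetCard (k + 1), ∑ i ∈ S, G (S.erase i) i =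
      ∑ R ∈ T.powersetCard k, ∑ i ∈ T \ R, G R i := by
  rw [Finset.sum_sigma', Finset.sum_sigma']
  refine Finset.sum_bij' (fun x _ => ⟨x.1.erase x.2, x.2⟩) (fun x _ => ⟨insert x.2 x.1, x.2⟩)
    ?_ ?_ ?_ ?_ ?_
  · rintro ⟨S, i⟩ h
    simp only [mem_sigma, mem_powersetCard, Finset.mem_sdiff] at h ⊢
    obtain ⟨⟨h1, h2⟩, h3⟩ := h
    refine ⟨⟨(erase_subset _ _).trans h1, ?_⟩, h1 h3, by simp⟩
    rw [card_erase_of_mem h3, h2]; rfl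
  · rintro ⟨R, i⟩ h
    simp only [mem_sigma, mem_powersetCard, Finset.mem_sdiff] at h ⊢
    obtain ⟨⟨h1, h2⟩, h3, h4⟩ := h
    exact ⟨⟨insert_subset h3 h1, by rw [card_insert_of_notMem h4, h2]⟩, by simp⟩
  · rintro ⟨S, i⟩ h
    simp only [mem_sigma] at h
    simp [insert_erase h.2]
  · rintro ⟨R, i⟩ h
    simp only [mem_sigma, Finset.mem_sdiff] at h
    simp [erase_insert h.2.2]
  · rintro ⟨S, i⟩ h
    rfl

variable [Fintype ι]

/-- The average of `F` over the `(n - 1)`-subsets obtained from the `n`-set `S` by the coupling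
that makes room for the pair `i, j`. -/
noncomputable def coupledMean (i j : ι) (F : Finset ι → ℝ) (S : Finset ι) : ℝ :=
  if i ∈ S then
    if j ∈ S then (∑ l ∈ Sᶜ, F (insert l ((S.erase i).erase j))) / (#Sᶜ : ℝ) else F (S.erase i)
  else
    if j ∈ S then F (S.erase j) else (∑ l ∈ S, F (S.erase l)) / (#S : ℝ)

theorem powersetCard_filter_notMem_notMem (n : ℕ) (i j : ι) :
    ((univ : Finset ι).powersetCard n).filter (fun S => i ∉ S ∧ j ∉ S) =
      (univ \ {i, j}).powersetCard n := by
  ext S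
  simp only [mem_filter, mem_powersetCard, subset_univ, true_and]
  rw [and_comm]
  refine and_congr_left fun _ => ⟨fun h x hx => ?_, fun h => ⟨fun h2 => ?_, fun h2 => ?_⟩⟩
  · simp only [Finset.mem_sdiff, mem_univ, mem_insert, mem_singleton, true_and]
    rintro (rfl | rfl)
    exacts [h.1 hx, h.2 hx]
  · simpa using h h2
  · simpa using h h2

theorem sum_filter_mem_notMem_erase (k : ℕ) {i j : ι} (hij : i ≠ j) (F : Finset ι → ℝ) :
    ∑ S ∈ ((univ : Finset ι).powersetCard (k + 1)).filter (fun S => i ∈ S ∧ j ∉ S),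
        F (S.erase i) =
      ∑ R ∈ ((univ : Finset ι).powersetCard k).filter (fun S => i ∉ S ∧ j ∉ S), F R := by
  refine Finset.sum_bij' (fun S _ => S.erase i) (fun R _ => insert i R) ?_ ?_ ?_ ?_ ?_
  · intro S h
    simp only [mem_filter, mem_powersetCard, subset_univ, true_and] at h ⊢
    refine ⟨by rw [card_erase_of_mem h.2.1, h.1]; rfl, by simp, by simp [h.2.2]⟩
  · intro S h
    simp only [mem_filter, mem_powersetCard, subset_univ, true_and] at h ⊢
    refine ⟨by rw [card_insert_of_notMem h.2.1, h.1], by simp, by simp [h.2.2, hij.symm]⟩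
  · intro S h
    simp only [mem_filter] at h
    exact insert_erase h.2.1
  · intro S h
    simp only [mem_filter] at h
    exact erase_insert h.2.1
  · intro S h
    rfl

/-- To recover `S` from the new set `R`, one only needs to know which of the `k` elements of `R` was
inserted. -/
theorem sum_filter_mem_mem_insert (k : ℕ) {i j : ι} (hij : i ≠ j) (F : Finset ι → ℝ) :
    ∑ S ∈ ((univ : Finset ι).powersetCard (k + 1)).filter (fun S => i ∈ S ∧ j ∈ S),
        ∑ l ∈ Sᶜ, F (insert l ((S.erase i).erase j)) =
      k * ∑ R ∈ ((univ : Finset ι).powersetCard k).filter (fun S => i ∉ S ∧ j ∉ S), F R := by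
  have h0 : (k : ℝ) * ∑ R ∈ ((univ : Finset ι).powersetCard k).filter
        (fun S => i ∉ S ∧ j ∉ S), F R =
      ∑ R ∈ ((univ : Finset ι).powersetCard k).filter (fun S => i ∉ S ∧ j ∉ S),
        ∑ l ∈ R, F R := by
    rw [mul_sum]
    refine sum_congr rfl fun R h => ?_
    simp only [mem_filter, mem_powersetCard] at h
    rw [sum_const, h.1.2, nsmul_eq_mul]
  rw [h0, Finset.sum_sigma', Finset.sum_sigma']
  refine Finset.sum_bij' (fun x _ => ⟨insert x.2 ((x.1.erase i).erase j), x.2⟩)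
    (fun x _ => ⟨insert i (insert j (x.1.erase x.2)), x.2⟩) ?_ ?_ ?_ ?_ ?_
  · rintro ⟨S, l⟩ h
    simp only [mem_sigma, mem_filter, mem_powersetCard, subset_univ, true_and, mem_compl] at h ⊢
    obtain ⟨⟨h1, h2, h3⟩, h4⟩ := h
    have hli : i ≠ l := fun h => h4 (h ▸ h2)
    have hlj : j ≠ l := fun h => h4 (h ▸ h3)
    refine ⟨⟨?_, by simp [hli], by simp [hlj]⟩, by simp⟩
    rw [card_insert_of_notMem (by simp [h4]), card_erase_of_mem (by simp [h3, hij.symm]),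
      card_erase_of_mem h2, h1]
    have : 0 < #(S.erase i) := card_pos.2 ⟨j, by simp [h3, hij.symm]⟩
    rw [card_erase_of_mem h2, h1] at this
    omega
  · rintro ⟨R, l⟩ h
    simp only [mem_sigma, mem_filter, mem_powersetCard, subset_univ, true_and, mem_compl] at h ⊢
    obtain ⟨⟨h1, h2, h3⟩, h4⟩ := h
    have hli : l ≠ i := fun h => h2 (h ▸ h4)
    have hlj : l ≠ j := fun h => h3 (h ▸ h4)
    refine ⟨⟨?_, by simp, by simp⟩, by simp [hli, hlj]⟩
    rw [card_insert_of_notMem (by simp [h2, hij]), card_insert_of_notMem (by simp [h3]),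
      card_erase_of_mem h4, h1]
    have : 0 < #R := card_pos.2 ⟨l, h4⟩
    omega
  · rintro ⟨S, l⟩ h
    simp only [mem_sigma, mem_filter, mem_compl] at h
    have h4 : l ∉ (S.erase i).erase j := by simp [h.2]
    simp only [erase_insert h4]
    rw [insert_erase (by simp [h.1.2.2, hij.symm]), insert_erase h.1.2.1]
  · rintro ⟨R, l⟩ h
    simp only [mem_sigma, mem_filter] at h
    have h3 : j ∉ R.erase l := by simp [h.1.2.2]
    have h2 : i ∉ insert j (R.erase l) := by simp [h.1.2.1, hij]
    simp only [erase_insert h2, erase_insert h3, insert_erase h.2]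
  · rintro ⟨S, l⟩ h
    rfl

/-- A `k`-set `R` avoiding `i, j` arises by deleting any one of the remaining `N - 2 - k` elements.
-/
theorem sum_filter_notMem_notMem_erase (k : ℕ) {i j : ι} (hij : i ≠ j)
    (hk : k + 2 ≤ Fintype.card ι) (F : Finset ι → ℝ) :
    ∑ S ∈ ((univ : Finset ι).powersetCard (k + 1)).filter (fun S => i ∉ S ∧ j ∉ S),
        ∑ l ∈ S, F (S.erase l) =
      (Fintype.card ι - 2 - k : ℝ) *
        ∑ R ∈ ((univ : Finset ι).powersetCard k).filter (fun S => i ∉ S ∧ j ∉ S), F R := by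
  rw [powersetCard_filter_notMem_notMem, powersetCard_filter_notMem_notMem,
    sum_powersetCard_succ_sum_erase _ _ (fun R _ => F R), mul_sum]
  refine sum_congr rfl fun R h => ?_
  rw [mem_powersetCard] at h
  rw [sum_const, nsmul_eq_mul, card_sdiff_of_subset h.1, h.2, card_sdiff_of_subset (subset_univ _),
    card_pair hij, card_univ]
  congr 1
  rw [Nat.cast_sub (by omega), Nat.cast_sub (by omega)]
  simp

/-- If `S` is uniform, the coupled set is uniform among the `(n - 1)`-sets avoiding `i, j`. Each
such set receives total weight `(N - 1 - n)/n + 1 + 1 + (n - 1)/(N - n)` from the four cases, which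
is `N (N - 1) / (n (N - n))`. -/
theorem sum_coupledMean (n : ℕ) (hn : 0 < n) (hN : n < Fintype.card ι) {i j : ι} (hij : i ≠ j)
    (F : Finset ι → ℝ) :
    (n * (Fintype.card ι - n) / (Fintype.card ι * (Fintype.card ι - 1)) : ℝ) *
      ∑ S ∈ (univ : Finset ι).powersetCard n, coupledMean i j F S =
      ∑ R ∈ ((univ : Finset ι).powersetCard (n - 1)).filter (fun S => i ∉ S ∧ j ∉ S), F R := by
  obtain ⟨k, rfl⟩ : ∃ k, n = k + 1 := ⟨n - 1, by omega⟩
  simp only [Nat.add_sub_cancel]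
  set 𝒮 := (univ : Finset ι).powersetCard (k + 1) with h𝒮
  set X := ∑ R ∈ ((univ : Finset ι).powersetCard k).filter (fun S => i ∉ S ∧ j ∉ S), F R with hX
  have e1 := sum_filter_notMem_notMem_erase k hij (by omega) F
  have e2 := sum_filter_mem_notMem_erase k hij F
  have e3 := sum_filter_mem_notMem_erase k hij.symm F
  have e4 := sum_filter_mem_mem_insert k hij F
  have e3' : ∑ S ∈ 𝒮.filter (fun S => i ∉ S ∧ j ∈ S), F (S.erase j) = X := by
    rw [hX]
    convert e3 using 2 <;> (ext S; simp only [mem_filter]; tauto)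
  rw [← h𝒮, ← hX] at e1 e2 e4
  have hsplit : ∑ S ∈ 𝒮, coupledMean i j F S =
      (∑ S ∈ 𝒮.filter (fun S => i ∈ S ∧ j ∈ S),
        ∑ l ∈ Sᶜ, F (insert l ((S.erase i).erase j))) / (Fintype.card ι - (k + 1))
      + ∑ S ∈ 𝒮.filter (fun S => i ∈ S ∧ j ∉ S), F (S.erase i)
      + (∑ S ∈ 𝒮.filter (fun S => i ∉ S ∧ j ∈ S), F (S.erase j)
      + (∑ S ∈ 𝒮.filter (fun S => i ∉ S ∧ j ∉ S), ∑ l ∈ S, F (S.erase l)) / (k + 1)) := by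
    rw [← sum_filter_add_sum_filter_not 𝒮 (fun S => i ∈ S),
      ← sum_filter_add_sum_filter_not (𝒮.filter (fun S => i ∈ S)) (fun S => j ∈ S),
      ← sum_filter_add_sum_filter_not (𝒮.filter (fun S => ¬ i ∈ S)) (fun S => j ∈ S)]
    simp only [filter_filter, sum_div]
    congr 1
    · congr 1
      · refine sum_congr rfl fun S h => ?_
        simp only [mem_filter, h𝒮, mem_powersetCard] at h
        rw [coupledMean, if_pos h.2.1, if_pos h.2.2, sum_div, card_compl, h.1.2,
          Nat.cast_sub hN.le]
        push_cast; rfl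
      · refine sum_congr rfl fun S h => ?_
        simp only [mem_filter] at h
        rw [coupledMean, if_pos h.2.1, if_neg h.2.2]
    · congr 1
      · refine sum_congr rfl fun S h => ?_
        simp only [mem_filter] at h
        rw [coupledMean, if_neg h.2.1, if_pos h.2.2]
      · refine sum_congr rfl fun S h => ?_
        simp only [mem_filter, h𝒮, mem_powersetCard] at h
        rw [coupledMean, if_neg h.2.1, if_neg h.2.2, sum_div, h.1.2]
        push_cast; rfl
  rw [hsplit, e1, e2, e3', e4]
  have hN' : (k : ℝ) + 1 < Fintype.card ι := by exact_mod_cast hN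
  have h1 : (Fintype.card ι : ℝ) - (k + 1) ≠ 0 := by linarith
  have h2 : (Fintype.card ι : ℝ) - 1 ≠ 0 := by
    have : (0 : ℝ) ≤ k := Nat.cast_nonneg k
    linarith
  have h3 : (Fintype.card ι : ℝ) ≠ 0 := by
    have : (0 : ℝ) ≤ k := Nat.cast_nonneg k
    linarith
  have h4 : (k : ℝ) + 1 ≠ 0 := by positivity
  push_cast
  field_simp
  ring

/-- The exchangeable pair identity for the sums over `n`-subsets of a centred population. -/
theorem sum_mul_eq_half_sum_pairs (n : ℕ) (hn : 0 < n) (a : ι → ℝ)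
    (h0 : ∑ i, a i = 0) (f : ℝ → ℝ) :
    (Fintype.card ι : ℝ) * ∑ S ∈ (univ : Finset ι).powersetCard n, (∑ i ∈ S, a i) * f (∑ i ∈ S, a i) =
      1 / 2 * ∑ i, ∑ j, (a i - a j) *
        ∑ R ∈ ((univ : Finset ι).powersetCard (n - 1)).filter (fun S => i ∉ S ∧ j ∉ S),
          (f (∑ l ∈ R, a l + a i) - f (∑ l ∈ R, a l + a j)) := by
  obtain ⟨k, rfl⟩ : ∃ k, n = k + 1 := ⟨n - 1, by omega⟩
  simp only [Nat.add_sub_cancel]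
  -- For `i ∈ S`, summing `a i - a j` over `j ∉ S` gives `#Sᶜ a i + W`, and summing that over `i ∈
  -- S` gives `N W`. The form `insert i (S.erase i)` makes the summand a function of `S.erase i` and
  -- `i`, as the reindexing requires.
  have e1 : (Fintype.card ι : ℝ) * ∑ S ∈ (univ : Finset ι).powersetCard (k + 1),
        (∑ i ∈ S, a i) * f (∑ i ∈ S, a i) =
      ∑ S ∈ (univ : Finset ι).powersetCard (k + 1), ∑ i ∈ S,
        ∑ j ∈ (insert i (S.erase i))ᶜ, (a i - a j) * f (∑ l ∈ S.erase i, a l + a i) := by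
    rw [mul_sum]
    refine sum_congr rfl fun S h => ?_
    have e : ∀ i ∈ S, ∑ j ∈ (insert i (S.erase i))ᶜ, (a i - a j) * f (∑ l ∈ S.erase i, a l + a i) =
        (#Sᶜ * a i + ∑ l ∈ S, a l) * f (∑ l ∈ S, a l) := by
      intro i hi
      rw [insert_erase hi, sum_erase_add _ _ hi, ← sum_mul, sum_sub_distrib, sum_const, nsmul_eq_mul]
      have := sum_add_sum_compl S a
      congr 1
      linarith
    rw [sum_congr rfl e, ← sum_mul, sum_add_distrib, ← mul_sum, sum_const, nsmul_eq_mul, ← add_mul]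
    have : (#Sᶜ : ℝ) + #S = Fintype.card ι := by
      rw [add_comm]
      exact_mod_cast card_add_card_compl S
    rw [this]
    ring
  rw [e1, sum_powersetCard_succ_sum_erase univ k
    (fun R i => ∑ j ∈ (insert i R)ᶜ, (a i - a j) * f (∑ l ∈ R, a l + a i))]
  have e2 : ∀ R ∈ (univ : Finset ι).powersetCard k, ∑ i ∈ univ \ R, ∑ j ∈ (insert i R)ᶜ,
      (a i - a j) * f (∑ l ∈ R, a l + a i) =
      ∑ i, ∑ j, if i ∉ R ∧ j ∉ R then (a i - a j) * f (∑ l ∈ R, a l + a i) else 0 := by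
    intro R _
    have : ∀ i ∈ univ \ R, ∑ j ∈ (insert i R)ᶜ, (a i - a j) * f (∑ l ∈ R, a l + a i) =
        ∑ j ∈ univ \ R, (a i - a j) * f (∑ l ∈ R, a l + a i) := by
      intro i hi
      refine sum_subset (fun x hx => ?_) fun x hx hx2 => ?_
      · simp only [mem_compl, mem_insert, not_or, Finset.mem_sdiff, mem_univ, true_and] at hx ⊢
        exact hx.2
      · simp only [mem_compl, mem_insert, not_or, Finset.mem_sdiff, mem_univ, true_and] at hx hx2
        have : x = i := by
          by_contra h
          exact hx2 ⟨h, hx⟩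
        rw [this]; simp
    rw [sum_congr rfl this]
    rw [← filter_notMem_eq_sdiff, sum_filter]
    refine sum_congr rfl fun i _ => ?_
    by_cases hi : i ∈ R
    · simp [hi]
    · simp only [hi, not_false_eq_true, if_true, true_and]
      rw [sum_filter]
  rw [sum_congr rfl e2, sum_comm]
  have e3 : ∀ i, ∑ R ∈ (univ : Finset ι).powersetCard k, ∑ j,
      (if i ∉ R ∧ j ∉ R then (a i - a j) * f (∑ l ∈ R, a l + a i) else 0) =
      ∑ j, (a i - a j) * ∑ R ∈ ((univ : Finset ι).powersetCard k).filter
        (fun S => i ∉ S ∧ j ∉ S), f (∑ l ∈ R, a l + a i) := by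
    intro i
    rw [sum_comm]
    refine sum_congr rfl fun j _ => ?_
    rw [mul_sum, sum_filter]
  simp_rw [e3]
  -- Exchanging `i` and `j` flips the sign; averaging the two forms yields the factor `1/2` and the
  -- difference of values of `f`.
  have e4 : ∑ i, ∑ j, (a i - a j) * ∑ R ∈ ((univ : Finset ι).powersetCard k).filter
        (fun S => i ∉ S ∧ j ∉ S), f (∑ l ∈ R, a l + a i) =
      ∑ i, ∑ j, -((a i - a j) * ∑ R ∈ ((univ : Finset ι).powersetCard k).filter
        (fun S => i ∉ S ∧ j ∉ S), f (∑ l ∈ R, a l + a j)) := by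
    rw [sum_comm]
    refine sum_congr rfl fun i _ => sum_congr rfl fun j _ => ?_
    simp only [and_comm]
    ring
  have e5 : ∀ x y : ℝ, x = y → x = 1 / 2 * (x + y) := by intro x y h; linarith
  rw [e5 _ _ e4, ← sum_add_distrib]
  congr 1
  refine sum_congr rfl fun i _ => ?_
  rw [← sum_add_distrib]
  refine sum_congr rfl fun j _ => ?_
  rw [sum_sub_distrib]
  ring

end Combinatorics

/-! ### Second order expansion of a difference -/

/-- Subtract from `f` its quadratic Taylor polynomial at `w`. The derivative of the remainder is
dominated by that of `M / 6 * (z - w) ^ 3`, so this cubic plus or minus the remainder is monotone.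
-/
theorem abs_sub_sub_le_of_second_order {f f' : ℝ → ℝ} (hf : ∀ x, HasDerivAt f (f' x) x)
    {w c M : ℝ} (h : ∀ z, |f' z - f' w - c * (z - w)| ≤ M / 2 * (z - w) ^ 2) (x y : ℝ) :
    |f x - f y - (x - y) * (f' w + c * (((x - w) + (y - w)) / 2))| ≤
      |x - y| * (M / 4 * ((x - w) ^ 2 + (y - w) ^ 2)) := by
  have hM : 0 ≤ M := by
    have := (abs_nonneg _).trans (h (w + 1))
    simp at this; linarith
  wlog hxy : y ≤ x generalizing x y
  · have := this y x (le_of_not_ge hxy)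
    rw [abs_sub_comm y x, ← abs_neg] at this
    convert this using 2 <;> ring
  have hd1 : ∀ z, HasDerivAt (fun z => M / 6 * (z - w) ^ 3 - (f z - f' w * z - c / 2 * (z - w) ^ 2))
      (M / 2 * (z - w) ^ 2 - (f' z - f' w - c * (z - w))) z := by
    intro z
    have h1 := ((hasDerivAt_id z).sub_const w)
    have := ((h1.pow 3).const_mul (M / 6)).sub
      (((hf z).sub ((hasDerivAt_id z).const_mul (f' w))).sub ((h1.pow 2).const_mul (c / 2)))
    refine this.congr_deriv ?_
    simp; ring
  have hd2 : ∀ z, HasDerivAt (fun z => M / 6 * (z - w) ^ 3 + (f z - f' w * z - c / 2 * (z - w) ^ 2))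
      (M / 2 * (z - w) ^ 2 + (f' z - f' w - c * (z - w))) z := by
    intro z
    have h1 := ((hasDerivAt_id z).sub_const w)
    have := ((h1.pow 3).const_mul (M / 6)).add
      (((hf z).sub ((hasDerivAt_id z).const_mul (f' w))).sub ((h1.pow 2).const_mul (c / 2)))
    refine this.congr_deriv ?_
    simp; ring
  have m1 := monotone_of_hasDerivAt_nonneg hd1 (fun z => by have := abs_le.1 (h z); simp; linarith) hxy
  have m2 := monotone_of_hasDerivAt_nonneg hd2 (fun z => by have := abs_le.1 (h z); simp; linarith) hxy
  simp only at m1 m2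
  rw [abs_of_nonneg (sub_nonneg.2 hxy)]
  -- The trapezoid rule overestimates the integral of the convex function `M / 2 * (z - w) ^ 2`,
  -- with excess `M / 12 * (x - y) ^ 3`.
  have key : M / 6 * (x - w) ^ 3 - M / 6 * (y - w) ^ 3 ≤
      (x - y) * (M / 4 * ((x - w) ^ 2 + (y - w) ^ 2)) := by
    have : (x - y) * (M / 4 * ((x - w) ^ 2 + (y - w) ^ 2)) -
      (M / 6 * (x - w) ^ 3 - M / 6 * (y - w) ^ 3) = M / 12 * (x - y) ^ 3 := by ring
    have h3 : 0 ≤ M / 12 * (x - y) ^ 3 := by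
      have := sub_nonneg.2 hxy
      positivity
    linarith
  rw [abs_le]
  constructor <;> nlinarith

/-! ### Coupled averages and moments of subset sums -/

section Combinatorics

open Finset

variable {ι : Type*} [DecidableEq ι] [Fintype ι]

theorem coupledMean_const (i j : ι) (c : ℝ) {S : Finset ι} (hS : S.Nonempty)
    (hS' : Sᶜ.Nonempty) : coupledMean i j (fun _ => c) S = c := by
  have h1 : (#S : ℝ) ≠ 0 := by exact_mod_cast hS.card_pos.ne'
  have h2 : (#Sᶜ : ℝ) ≠ 0 := by exact_mod_cast hS'.card_pos.ne'
  unfold coupledMean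
  split_ifs <;> simp only [sum_const, nsmul_eq_mul] <;> field_simp

theorem coupledMean_add (i j : ι) (F G : Finset ι → ℝ) (S : Finset ι) :
    coupledMean i j (fun R => F R + G R) S = coupledMean i j F S + coupledMean i j G S := by
  unfold coupledMean
  split_ifs <;> simp only [sum_add_distrib, add_div]

theorem coupledMean_const_mul (i j : ι) (c : ℝ) (F : Finset ι → ℝ) (S : Finset ι) :
    coupledMean i j (fun R => c * F R) S = c * coupledMean i j F S := by
  unfold coupledMean
  split_ifs <;> simp only [← mul_sum, mul_div_assoc]

theorem abs_coupledMean_le (i j : ι) {F G : Finset ι → ℝ} (h : ∀ R, |F R| ≤ G R)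
    (S : Finset ι) : |coupledMean i j F S| ≤ coupledMean i j G S := by
  unfold coupledMean
  split_ifs
  · rw [abs_div, Nat.abs_cast]
    gcongr
    exact (abs_sum_le_sum_abs _ _).trans (sum_le_sum fun _ _ => h _)
  · exact h _
  · exact h _
  · rw [abs_div, Nat.abs_cast]
    gcongr
    exact (abs_sum_le_sum_abs _ _).trans (sum_le_sum fun _ _ => h _)

theorem sum_mul_eq_sum_coupledMean (n : ℕ) (hn : 0 < n) (hN : n < Fintype.card ι) (a : ι → ℝ)
    (h0 : ∑ i, a i = 0) (f : ℝ → ℝ) :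
    (Fintype.card ι : ℝ) * ∑ S ∈ (univ : Finset ι).powersetCard n, (∑ i ∈ S, a i) * f (∑ i ∈ S, a i) =
      (n * (Fintype.card ι - n) / (Fintype.card ι * (Fintype.card ι - 1)) : ℝ) *
      ∑ S ∈ (univ : Finset ι).powersetCard n, 1 / 2 * ∑ i, ∑ j, (a i - a j) *
        coupledMean i j (fun R => f (∑ l ∈ R, a l + a i) - f (∑ l ∈ R, a l + a j)) S := by
  rw [sum_mul_eq_half_sum_pairs n hn a h0 f]
  have e : ∀ (s t : ℝ) (T : Finset (Finset ι)) (g : Finset ι → ℝ),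
      t * ∑ S ∈ T, s * g S = s * (t * ∑ S ∈ T, g S) := by
    intro s t T g
    rw [← mul_sum, mul_left_comm]
  rw [e]
  congr 1
  symm
  rw [sum_comm, mul_sum]
  refine sum_congr rfl fun i _ => ?_
  rw [sum_comm, mul_sum]
  refine sum_congr rfl fun j _ => ?_
  rw [← mul_sum, mul_left_comm]
  by_cases hij : i = j
  · simp [hij]
  · rw [sum_coupledMean n hn hN hij]

theorem nonempty_of_mem_powersetCard {n : ℕ} (hn : 0 < n) (hN : n < Fintype.card ι)
    {S : Finset ι} (hS : S ∈ (univ : Finset ι).powersetCard n) : S.Nonempty ∧ Sᶜ.Nonempty := by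
  rw [mem_powersetCard] at hS
  refine ⟨card_pos.1 (by omega), card_pos.1 ?_⟩
  rw [card_compl]
  omega

theorem sum_sum_sq_sub {ι : Type*} [Fintype ι] (a : ι → ℝ) (h0 : ∑ i, a i = 0) :
    ∑ i, ∑ j, (a i - a j) ^ 2 = 2 * Fintype.card ι * ∑ i, a i ^ 2 := by
  have : ∀ i, ∑ j, (a i - a j) ^ 2 =
      Fintype.card ι * a i ^ 2 + ∑ j, a j ^ 2 := by
    intro i
    simp only [sub_sq, sum_add_distrib, sum_sub_distrib, ← mul_sum, h0, sum_const, nsmul_eq_mul,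
      card_univ]
    ring
  simp_rw [this, sum_add_distrib, ← mul_sum, sum_const, nsmul_eq_mul, card_univ]
  ring

/-- The variance of the sum of a simple random sample from a centred population. -/
theorem sum_sq_subset_sum (n : ℕ) (hn : 0 < n) (hN : n < Fintype.card ι) (a : ι → ℝ)
    (h0 : ∑ i, a i = 0) :
    ∑ S ∈ (univ : Finset ι).powersetCard n, (∑ i ∈ S, a i) ^ 2 =
      (n * (Fintype.card ι - n) / (Fintype.card ι * (Fintype.card ι - 1)) : ℝ) *
      (#((univ : Finset ι).powersetCard n) * ∑ i, a i ^ 2) := by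
  -- With `f = id` each difference is the constant `a i - a j`, so the coupling plays no role and
  -- the identity computes the variance.
  have h := sum_mul_eq_sum_coupledMean n hn hN a h0 id
  have hN0 : (Fintype.card ι : ℝ) ≠ 0 := by
    have : 0 < Fintype.card ι := by omega
    positivity
  apply mul_left_cancel₀ hN0
  simp only [id, ← sq, add_sub_add_left_eq_sub] at h
  rw [h, mul_left_comm]
  congr 1
  have : ∀ S ∈ (univ : Finset ι).powersetCard n, 1 / 2 * ∑ i, ∑ j, (a i - a j) *
      coupledMean i j (fun _ => a i - a j) S = Fintype.card ι * ∑ i, a i ^ 2 := by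
    intro S hS
    obtain ⟨h1, h2⟩ := nonempty_of_mem_powersetCard hn hN hS
    simp_rw [coupledMean_const _ _ _ h1 h2, ← sq]
    rw [sum_sum_sq_sub a h0]
    ring
  rw [sum_congr rfl this, sum_const, nsmul_eq_mul]
  ring

theorem sum_subset_sum (n : ℕ) (hn : 0 < n) (b : ι → ℝ) :
    (Fintype.card ι : ℝ) * ∑ S ∈ (univ : Finset ι).powersetCard n, ∑ i ∈ S, b i =
      n * (#((univ : Finset ι).powersetCard n) * ∑ i, b i) := by
  have hi : ∀ i, (Fintype.card ι : ℝ) * ∑ S ∈ (univ : Finset ι).powersetCard n,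
      (if i ∈ S then (1 : ℝ) else 0) = n * #((univ : Finset ι).powersetCard n) := by
    intro i
    rw [← sum_filter, sum_const, nsmul_eq_mul, mul_one, card_powersetCard, card_univ]
    obtain ⟨k, rfl⟩ : ∃ k, n = k + 1 := ⟨n - 1, by omega⟩
    have : #(filter (fun S => i ∈ S) ((univ : Finset ι).powersetCard (k + 1))) =
        (Fintype.card ι - 1).choose k := by
      rw [← card_univ, ← card_erase_of_mem (mem_univ i), ← card_powersetCard]
      refine card_bij' (fun S _ => S.erase i) (fun S _ => insert i S) ?_ ?_ ?_ ?_
      · intro S h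
        simp only [mem_filter, mem_powersetCard, subset_univ, true_and] at h ⊢
        exact ⟨erase_subset_erase _ (subset_univ _), by rw [card_erase_of_mem h.2, h.1]; rfl⟩
      · intro S h
        simp only [mem_filter, mem_powersetCard, subset_univ, true_and] at h ⊢
        have : i ∉ S := fun h2 => by simpa using h.1 h2
        exact ⟨by rw [card_insert_of_notMem this, h.2], by simp⟩
      · intro S h
        exact insert_erase (mem_filter.1 h).2
      · intro S h
        rw [mem_powersetCard] at h
        exact erase_insert fun h2 => by simpa using h.1 h2
    rw [this]
    have hc : 0 < Fintype.card ι := Fintype.card_pos_iff.2 ⟨i⟩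
    obtain ⟨M, hM⟩ : ∃ M, Fintype.card ι = M + 1 := ⟨Fintype.card ι - 1, by omega⟩
    rw [hM, Nat.add_sub_cancel]
    have := Nat.add_one_mul_choose_eq M k
    rw [mul_comm ((k + 1 : ℕ) : ℝ)]
    exact_mod_cast this
  have e : ∀ S : Finset ι, ∑ i ∈ S, b i = ∑ i, b i * (if i ∈ S then (1 : ℝ) else 0) := by
    intro S
    simp
  rw [sum_congr rfl fun S _ => e S, sum_comm, mul_sum, mul_sum, mul_sum]
  refine sum_congr rfl fun i _ => ?_
  rw [← mul_sum, mul_left_comm, hi]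
  ring

end Combinatorics

/-! ### The zero bias drift and the zero bias estimate -/

section Combinatorics

open Finset

theorem sum_sum_sq_sub_mul {ι : Type*} [Fintype ι] (a u v : ι → ℝ) :
    ∑ i, ∑ j, (a i - a j) ^ 2 * (u i * v j) =
      (∑ i, u i * a i ^ 2) * ∑ j, v j - 2 * (∑ i, u i * a i) * (∑ j, v j * a j) +
        (∑ i, u i) * ∑ j, v j * a j ^ 2 := by
  rw [mul_assoc, sum_mul_sum, sum_mul_sum, sum_mul_sum, mul_sum, ← sum_sub_distrib,
    ← sum_add_distrib]
  refine sum_congr rfl fun i _ => ?_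
  rw [mul_sum, ← sum_sub_distrib, ← sum_add_distrib]
  exact sum_congr rfl fun j _ => by ring

variable {ι : Type*} [DecidableEq ι] [Fintype ι]

/-- The conditional mean given the sample `S` of the displacement between the sample sum and its
zero biased version. -/
noncomputable def zeroBiasDrift (a : ι → ℝ) (S : Finset ι) : ℝ :=
  1 / (2 * Fintype.card ι) * ∑ i, ∑ j, (a i - a j) ^ 2 *
    coupledMean i j (fun R => ∑ l ∈ R, a l + (a i + a j) / 2 - ∑ l ∈ S, a l) S

/-- The zero biased sum is uniform on the segment between the two endpoints `R + a i` and `R + a j`,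
hence the midpoint. Writing the four cases with indicators makes the later sum over `i, j` split
into products of single sums. -/
theorem coupledMean_midpoint (a : ι → ℝ) (h0 : ∑ i, a i = 0) {S : Finset ι} (hS : S.Nonempty)
    (hS' : Sᶜ.Nonempty) {i j : ι} (hij : i ≠ j) :
    coupledMean i j (fun R => ∑ l ∈ R, a l + (a i + a j) / 2 - ∑ l ∈ S, a l) S =
      (a i + a j) / 2 - (if i ∈ S then 1 else 0) * a i - (if j ∈ S then 1 else 0) * a j
        - (if i ∈ S then 0 else 1) * (if j ∈ S then 0 else 1) * ((∑ l ∈ S, a l) / #S)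
        - (if i ∈ S then 1 else 0) * (if j ∈ S then 1 else 0) * ((∑ l ∈ S, a l) / #Sᶜ) := by
  have h1 : (#S : ℝ) ≠ 0 := by exact_mod_cast hS.card_pos.ne'
  have h2 : (#Sᶜ : ℝ) ≠ 0 := by exact_mod_cast hS'.card_pos.ne'
  have hc : ∑ l ∈ Sᶜ, a l = - ∑ l ∈ S, a l := by
    have := sum_add_sum_compl S a
    linarith
  unfold coupledMean
  by_cases hi : i ∈ S <;> by_cases hj : j ∈ S <;> simp only [hi, hj, if_true, if_false]
  · have : ∀ l ∈ Sᶜ, ∑ k ∈ insert l ((S.erase i).erase j), a k + (a i + a j) / 2 - ∑ l ∈ S, a l =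
        a l - (a i + a j) / 2 := by
      intro l hl
      rw [mem_compl] at hl
      rw [sum_insert (by simp [hl]), sum_erase_eq_sub (by simp [hj, hij.symm]), sum_erase_eq_sub hi]
      ring
    rw [sum_congr rfl this, sum_sub_distrib, hc, sum_const, nsmul_eq_mul]
    field_simp
    ring
  · rw [sum_erase_eq_sub hi]
    ring
  · rw [sum_erase_eq_sub hj]
    ring
  · have : ∀ l ∈ S, ∑ k ∈ S.erase l, a k + (a i + a j) / 2 - ∑ l ∈ S, a l =
        (a i + a j) / 2 - a l := by
      intro l hl
      rw [sum_erase_eq_sub hl]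
      ring
    rw [sum_congr rfl this, sum_sub_distrib, sum_const, nsmul_eq_mul]
    field_simp
    ring

/-- In every case the displacements are `0` or signed differences of two population values, so `(u -
v)² ≤ 2u² + 2v²` suffices. Each case needs at most one of the two averages; keeping both gives one
bound for all cases. -/
theorem coupledMean_sq_le (a : ι → ℝ) {S : Finset ι} (hS : S.Nonempty)
    (hS' : Sᶜ.Nonempty) {i j : ι} (hij : i ≠ j) :
    coupledMean i j (fun R => ((∑ l ∈ R, a l + a i - ∑ l ∈ S, a l) ^ 2 +
      (∑ l ∈ R, a l + a j - ∑ l ∈ S, a l) ^ 2) / 2) S ≤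
      a i ^ 2 + a j ^ 2 + 2 * ((∑ l ∈ S, a l ^ 2) / #S) + 2 * ((∑ l ∈ Sᶜ, a l ^ 2) / #Sᶜ) := by
  have h1 : (0 : ℝ) < #S := by exact_mod_cast hS.card_pos
  have h2 : (0 : ℝ) < #Sᶜ := by exact_mod_cast hS'.card_pos
  have n1 : 0 ≤ (∑ l ∈ S, a l ^ 2) / #S := by positivity
  have n2 : 0 ≤ (∑ l ∈ Sᶜ, a l ^ 2) / #Sᶜ := by positivity
  unfold coupledMean
  split_ifs with hi hj hj
  · have : ∀ l ∈ Sᶜ, ((∑ k ∈ insert l ((S.erase i).erase j), a k + a i - ∑ l ∈ S, a l) ^ 2 +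
        (∑ k ∈ insert l ((S.erase i).erase j), a k + a j - ∑ l ∈ S, a l) ^ 2) / 2 ≤
        a i ^ 2 + a j ^ 2 + 2 * a l ^ 2 := by
      intro l hl
      rw [mem_compl] at hl
      rw [sum_insert (by simp [hl]), sum_erase_eq_sub (by simp [hj, hij.symm]), sum_erase_eq_sub hi]
      nlinarith [sq_nonneg (a l + a i), sq_nonneg (a l + a j)]
    have := sum_le_sum this
    rw [sum_add_distrib, sum_const, nsmul_eq_mul, ← mul_sum] at this
    have := div_le_div_of_nonneg_right this h2.le
    rw [add_div, mul_div_cancel_left₀ _ h2.ne', mul_div_assoc] at this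
    linarith
  · beta_reduce
    rw [sum_erase_eq_sub hi]
    nlinarith [sq_nonneg (a i + a j), sq_nonneg (a i), sq_nonneg (a j)]
  · beta_reduce
    rw [sum_erase_eq_sub hj]
    nlinarith [sq_nonneg (a i + a j), sq_nonneg (a i), sq_nonneg (a j)]
  · have : ∀ l ∈ S, ((∑ k ∈ S.erase l, a k + a i - ∑ l ∈ S, a l) ^ 2 +
        (∑ k ∈ S.erase l, a k + a j - ∑ l ∈ S, a l) ^ 2) / 2 ≤
        a i ^ 2 + a j ^ 2 + 2 * a l ^ 2 := by
      intro l hl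
      rw [sum_erase_eq_sub hl]
      nlinarith [sq_nonneg (a l + a i), sq_nonneg (a l + a j)]
    have := sum_le_sum this
    rw [sum_add_distrib, sum_const, nsmul_eq_mul, ← mul_sum] at this
    have := div_le_div_of_nonneg_right this h1.le
    rw [add_div, mul_div_cancel_left₀ _ h1.ne', mul_div_assoc] at this
    linarith

-- The midpoint terms cancel over all pairs because `∑ a = ∑ a³ = 0`; the indicator terms sum to
-- `-T3 - c W`, with `T3` the sum of cubes over `S`.
set_option maxHeartbeats 400000 in
theorem zeroBiasDrift_sq_le (a : ι → ℝ) (h0 : ∑ i, a i = 0) (h2 : ∑ i, a i ^ 2 = 1)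
    (h3 : ∑ i, a i ^ 3 = 0) {S : Finset ι} (hS : S.Nonempty)
    (hS' : Sᶜ.Nonempty) {K : ℝ} (hK : 1 / (#S : ℝ) ≤ K) (hK' : 1 / (#Sᶜ : ℝ) ≤ K) :
    zeroBiasDrift a S ^ 2 ≤ 2 * (∑ i ∈ S, a i ^ 3) ^ 2 + 2 * (K ^ 2 * (∑ i ∈ S, a i) ^ 2) := by
  have e1 : ∀ u v : ℝ, (-u - v) ^ 2 ≤ 2 * u ^ 2 + 2 * v ^ 2 := by
    intro u v
    nlinarith [sq_nonneg (u - v)]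
  have hn : (0 : ℝ) < #S := by exact_mod_cast hS.card_pos
  have hm : (0 : ℝ) < #Sᶜ := by exact_mod_cast hS'.card_pos
  have hN : (Fintype.card ι : ℝ) = #S + #Sᶜ := by exact_mod_cast (card_add_card_compl S).symm
  have hN0 : (0 : ℝ) < Fintype.card ι := by rw [hN]; positivity
  have hc1 : ∑ l ∈ Sᶜ, a l = - ∑ l ∈ S, a l := by
    have := sum_add_sum_compl S a
    linarith
  have hc2 : ∑ l ∈ Sᶜ, a l ^ 2 = 1 - ∑ l ∈ S, a l ^ 2 := by
    have := sum_add_sum_compl S (fun l => a l ^ 2)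
    linarith
  set W := ∑ i ∈ S, a i with hW
  set T2 := ∑ i ∈ S, a i ^ 2 with hT2
  set T3 := ∑ i ∈ S, a i ^ 3 with hT3
  set x : ι → ℝ := fun i => if i ∈ S then 1 else 0 with hx
  set y : ι → ℝ := fun i => if i ∈ S then 0 else 1 with hy
  have sx : ∀ g : ι → ℝ, ∑ i, x i * g i = ∑ i ∈ S, g i := by
    intro g
    simp [hx]
  have sy : ∀ g : ι → ℝ, ∑ i, y i * g i = ∑ i ∈ Sᶜ, g i := by
    intro g
    rw [← sum_filter_add_sum_filter_not univ (fun i => i ∈ S)]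
    have e1 : ∑ i ∈ univ.filter (fun i => i ∈ S), y i * g i = 0 :=
      sum_eq_zero fun i hi => by simp [hy, (mem_filter.1 hi).2]
    rw [e1, zero_add]
    refine sum_congr (by ext; simp) fun i hi => by simp [hy, (mem_compl.1 hi)]
  have sx0 : ∑ i, x i = #S := by simpa using sx (fun _ => 1)
  have sy0 : ∑ i, y i = #Sᶜ := by simpa using sy (fun _ => 1)
  have p2 : ∑ i, ∑ j, (a i - a j) ^ 2 * (x i * x j) = 2 * #S * T2 - 2 * W ^ 2 := by
    rw [sum_sum_sq_sub_mul, sx, sx, sx0]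
    ring
  have p0 : ∑ i, ∑ j, (a i - a j) ^ 2 * (y i * y j) = 2 * #Sᶜ * (1 - T2) - 2 * W ^ 2 := by
    rw [sum_sum_sq_sub_mul, sy, sy, sy0, hc1, hc2]
    ring
  have p1 : ∑ i, ∑ j, (a i - a j) ^ 2 * ((x i * a i) * 1) = Fintype.card ι * T3 + W := by
    rw [sum_sum_sq_sub_mul]
    have e : ∀ i, x i * a i * a i ^ 2 = x i * a i ^ 3 := fun i => by ring
    simp_rw [one_mul, e, h2, h0, sx]
    simp
    ring
  have p1' : ∑ i, ∑ j, (a i - a j) ^ 2 * (1 * (x j * a j)) = Fintype.card ι * T3 + W := by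
    rw [← p1, sum_comm]
    exact sum_congr rfl fun i _ => sum_congr rfl fun j _ => by ring
  have p4 : ∑ i, ∑ j, (a i - a j) ^ 2 * (a i * 1) = 0 := by
    rw [sum_sum_sq_sub_mul]
    have e : ∀ i, a i * a i ^ 2 = a i ^ 3 := fun i => by ring
    simp [e, h0, h3]
  have p4' : ∑ i, ∑ j, (a i - a j) ^ 2 * (1 * a j) = 0 := by
    rw [← p4, sum_comm]
    exact sum_congr rfl fun i _ => sum_congr rfl fun j _ => by ring
  -- As a sum of squares with nonnegative weights this is nonnegative; with `q2` it gives `0 ≤ c`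
  -- below.
  have q0 : 0 ≤ 2 * #Sᶜ * (1 - T2) - 2 * W ^ 2 := by
    rw [← p0]
    refine sum_nonneg fun i _ => sum_nonneg fun j _ => mul_nonneg (sq_nonneg _) (mul_nonneg ?_ ?_)
    all_goals
      simp only [hy]
      split_ifs <;> norm_num
  have q2 : 0 ≤ 2 * #S * T2 - 2 * W ^ 2 := by
    rw [← p2]
    refine sum_nonneg fun i _ => sum_nonneg fun j _ => mul_nonneg (sq_nonneg _) (mul_nonneg ?_ ?_)
    all_goals
      simp only [hx]
      split_ifs <;> norm_num
  have key : zeroBiasDrift a S = -T3 - (1 / Fintype.card ι +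
      ((2 * #Sᶜ * (1 - T2) - 2 * W ^ 2) / #S + (2 * #S * T2 - 2 * W ^ 2) / #Sᶜ) /
        (2 * Fintype.card ι)) * W := by
    unfold zeroBiasDrift
    have : ∀ i, ∀ j, (a i - a j) ^ 2 *
        coupledMean i j (fun R => ∑ l ∈ R, a l + (a i + a j) / 2 - ∑ l ∈ S, a l) S =
        1 / 2 * ((a i - a j) ^ 2 * (a i * 1)) + 1 / 2 * ((a i - a j) ^ 2 * (1 * a j))
        - (a i - a j) ^ 2 * ((x i * a i) * 1) - (a i - a j) ^ 2 * (1 * (x j * a j))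
        - W / #S * ((a i - a j) ^ 2 * (y i * y j)) - W / #Sᶜ * ((a i - a j) ^ 2 * (x i * x j)) := by
      intro i j
      by_cases hij : i = j
      · simp [hij]
      · rw [coupledMean_midpoint a h0 hS hS' hij]
        simp only [hx, hy]
        ring
    simp_rw [this, sum_sub_distrib, sum_add_distrib, ← mul_sum, p0, p2, p1, p1', p4, p4']
    field_simp
    ring
  set c := 1 / (Fintype.card ι : ℝ) +
      ((2 * #Sᶜ * (1 - T2) - 2 * W ^ 2) / #S + (2 * #S * T2 - 2 * W ^ 2) / #Sᶜ) /
        (2 * Fintype.card ι) with hc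
  have c0 : 0 ≤ c := by positivity
  have T0 : 0 ≤ T2 := sum_nonneg fun _ _ => sq_nonneg _
  have T1 : 0 ≤ 1 - T2 := by
    rw [← hc2]
    exact sum_nonneg fun _ _ => sq_nonneg _
  have cK : c ≤ K := by
    -- Up to a nonpositive term, `c` is a convex combination of `1/n` and `1/(N - n)`: the weights
    -- add to `1` because `∑ a² = 1`.
    have e : c = (1 - T2) * (1 / #S) + T2 * (1 / #Sᶜ) - W ^ 2 / (#S * #Sᶜ) := by
      rw [hc, hN]
      field_simp
      ring
    have : 0 ≤ W ^ 2 / (#S * #Sᶜ) := by positivity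
    rw [e]
    linarith [mul_le_mul_of_nonneg_left hK T1, mul_le_mul_of_nonneg_left hK' T0]
  rw [key]
  have e2 : c ^ 2 * W ^ 2 ≤ K ^ 2 * W ^ 2 :=
    mul_le_mul_of_nonneg_right (pow_le_pow_left₀ c0 cK 2) (sq_nonneg W)
  have e3 := e1 T3 (c * W)
  rw [mul_pow] at e3
  linarith

/-- The variance formula applies to the population `a³` as well, since it too is centred. -/
theorem sum_zeroBiasDrift_sq_le (n : ℕ) (hn : 0 < n) (hN : n < Fintype.card ι) (a : ι → ℝ)
    (h0 : ∑ i, a i = 0) (h2 : ∑ i, a i ^ 2 = 1) (h3 : ∑ i, a i ^ 3 = 0) {K : ℝ}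
    (hK : 1 / (n : ℝ) ≤ K) (hK' : 1 / (Fintype.card ι - n : ℝ) ≤ K) :
    ∑ S ∈ (univ : Finset ι).powersetCard n, zeroBiasDrift a S ^ 2 ≤
      #((univ : Finset ι).powersetCard n) *
      (2 * (n * (Fintype.card ι - n) / (Fintype.card ι * (Fintype.card ι - 1))) *
        (∑ i, a i ^ 6 + K ^ 2)) := by
  have h : ∀ S ∈ (univ : Finset ι).powersetCard n, zeroBiasDrift a S ^ 2 ≤
      2 * (∑ i ∈ S, a i ^ 3) ^ 2 + 2 * (K ^ 2 * (∑ i ∈ S, a i) ^ 2) := by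
    intro S hS
    obtain ⟨e1, e2⟩ := nonempty_of_mem_powersetCard hn hN hS
    rw [mem_powersetCard] at hS
    refine zeroBiasDrift_sq_le a h0 h2 h3 e1 e2 (by rwa [hS.2]) ?_
    rwa [card_compl, hS.2, Nat.cast_sub hN.le]
  refine (sum_le_sum h).trans (le_of_eq ?_)
  rw [sum_add_distrib, ← mul_sum, ← mul_sum, ← mul_sum, sum_sq_subset_sum n hn hN a h0,
    sum_sq_subset_sum n hn hN (fun i => a i ^ 3) h3, h2]
  simp_rw [← pow_mul]
  ring

/-- Per sample, the coupled pair sum is expanded at `w`: the first order term gives `f'`, the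
midpoint term gives `f''` times the drift, and the remainder is controlled by the mean squared
displacement of the endpoints. -/
theorem abs_sum_coupledMean_sub_le (a : ι → ℝ) (h0 : ∑ i, a i = 0) (h2 : ∑ i, a i ^ 2 = 1)
    {S : Finset ι} (hS : S.Nonempty) (hS' : Sᶜ.Nonempty) {f f' f'' : ℝ → ℝ} {M : ℝ}
    (hf : ∀ x, HasDerivAt f (f' x) x)
    (hM : ∀ w z, |f' z - f' w - f'' w * (z - w)| ≤ M / 2 * (z - w) ^ 2) :
    |1 / 2 * ∑ i, ∑ j, (a i - a j) *
        coupledMean i j (fun R => f (∑ l ∈ R, a l + a i) - f (∑ l ∈ R, a l + a j)) S -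
      Fintype.card ι * (f' (∑ l ∈ S, a l) + f'' (∑ l ∈ S, a l) * zeroBiasDrift a S)| ≤
    M / 2 * (Fintype.card ι * (∑ i, a i ^ 4 + 2 * ((∑ l ∈ S, a l ^ 2) / #S) +
      2 * ((∑ l ∈ Sᶜ, a l ^ 2) / #Sᶜ)) + 1) := by
  have hM0 : 0 ≤ M := by
    have := (abs_nonneg _).trans (hM 0 1)
    simp at this; linarith
  have hN0 : (Fintype.card ι : ℝ) ≠ 0 := by
    have : 0 < Fintype.card ι := Fintype.card_pos_iff.2 ⟨hS.choose⟩
    positivity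
  set w := ∑ l ∈ S, a l with hw
  set B := 2 * ((∑ l ∈ S, a l ^ 2) / #S) + 2 * ((∑ l ∈ Sᶜ, a l ^ 2) / #Sᶜ) with hB
  have e1 : Fintype.card ι * (f' w + f'' w * zeroBiasDrift a S) =
      1 / 2 * ∑ i, ∑ j, ((a i - a j) ^ 2 * f' w + f'' w * ((a i - a j) ^ 2 *
        coupledMean i j (fun R => ∑ l ∈ R, a l + (a i + a j) / 2 - w) S)) := by
    simp_rw [sum_add_distrib, ← mul_sum, ← sum_mul]
    rw [sum_sum_sq_sub a h0, h2, zeroBiasDrift, ← hw]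
    field_simp
  rw [e1, ← mul_sub, ← sum_sub_distrib]
  simp_rw [← sum_sub_distrib]
  have hpt : ∀ i j, |(a i - a j) * coupledMean i j
      (fun R => f (∑ l ∈ R, a l + a i) - f (∑ l ∈ R, a l + a j)) S -
      ((a i - a j) ^ 2 * f' w + f'' w * ((a i - a j) ^ 2 *
        coupledMean i j (fun R => ∑ l ∈ R, a l + (a i + a j) / 2 - w) S))| ≤
      M / 2 * ((a i - a j) ^ 2 * (a i ^ 2 * 1) + (a i - a j) ^ 2 * (1 * a j ^ 2) +
        B * (a i - a j) ^ 2) := by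
    intro i j
    by_cases hij : i = j
    · simp [hij]
    have e2 : coupledMean i j (fun R => f (∑ l ∈ R, a l + a i) - f (∑ l ∈ R, a l + a j)) S -
        ((a i - a j) * f' w + (a i - a j) * f'' w *
          coupledMean i j (fun R => ∑ l ∈ R, a l + (a i + a j) / 2 - w) S) =
        coupledMean i j (fun R => f (∑ l ∈ R, a l + a i) - f (∑ l ∈ R, a l + a j) +
          (-1) * ((a i - a j) * f' w + (a i - a j) * f'' w *
            (∑ l ∈ R, a l + (a i + a j) / 2 - w))) S := by
      rw [coupledMean_add i j (fun R => f (∑ l ∈ R, a l + a i) - f (∑ l ∈ R, a l + a j)),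
        coupledMean_const_mul, coupledMean_add i j (fun _ => (a i - a j) * f' w),
        coupledMean_const _ _ _ hS hS', coupledMean_const_mul]
      ring
    have e3 : |coupledMean i j (fun R => f (∑ l ∈ R, a l + a i) - f (∑ l ∈ R, a l + a j) +
          (-1) * ((a i - a j) * f' w + (a i - a j) * f'' w *
            (∑ l ∈ R, a l + (a i + a j) / 2 - w))) S| ≤
        coupledMean i j (fun R => (|a i - a j| * (M / 2)) * (((∑ l ∈ R, a l + a i - w) ^ 2 +
          (∑ l ∈ R, a l + a j - w) ^ 2) / 2)) S := by
      refine abs_coupledMean_le i j (fun R => ?_) S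
      have := abs_sub_sub_le_of_second_order hf (hM w) (∑ l ∈ R, a l + a i) (∑ l ∈ R, a l + a j)
      rw [add_sub_add_left_eq_sub] at this
      convert this using 1
      · congr 1
        ring
      · ring
    rw [coupledMean_const_mul, ← e2] at e3
    have e4 := e3.trans (mul_le_mul_of_nonneg_left (coupledMean_sq_le a hS hS' hij) (by positivity))
    have e5 := mul_le_mul_of_nonneg_left e4 (abs_nonneg (a i - a j))
    rw [← abs_mul] at e5
    have e6 : |a i - a j| * |a i - a j| = (a i - a j) ^ 2 := by rw [← sq, sq_abs]
    calc _ = _ := by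
          congr 1
          ring
      _ ≤ _ := e5
      _ = (|a i - a j| * |a i - a j|) * (M / 2) * (a i ^ 2 + a j ^ 2 + B) := by
          rw [hB]
          ring
      _ = _ := by
          rw [e6]
          ring
  rw [abs_mul, abs_of_pos (by norm_num : (0 : ℝ) < 1 / 2)]
  have h4 : ∑ i, ∑ j, (a i - a j) ^ 2 * (a i ^ 2 * 1) = Fintype.card ι * ∑ i, a i ^ 4 + 1 := by
    rw [sum_sum_sq_sub_mul]
    have e : ∀ i, a i ^ 2 * a i ^ 2 = a i ^ 4 := fun i => by ring
    simp [e, h0, h2]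
    ring
  have h4' : ∑ i, ∑ j, (a i - a j) ^ 2 * (1 * a j ^ 2) = Fintype.card ι * ∑ i, a i ^ 4 + 1 := by
    rw [← h4, sum_comm]
    exact sum_congr rfl fun i _ => sum_congr rfl fun j _ => by ring
  have hsum := (abs_sum_le_sum_abs _ _).trans (sum_le_sum fun i (_ : i ∈ univ) =>
    (abs_sum_le_sum_abs _ _).trans (sum_le_sum fun j (_ : j ∈ univ) => hpt i j))
  simp_rw [← mul_sum, sum_add_distrib, ← mul_sum, h4, h4', sum_sum_sq_sub a h0, h2] at hsum
  refine (mul_le_mul_of_nonneg_left hsum (by norm_num)).trans (le_of_eq ?_)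
  rw [hB]
  ring

/-- A quantitative form of the zero bias identity for the sum of a simple random sample. -/
theorem abs_sum_mul_sub_le (n : ℕ) (hn : 0 < n) (hN : n < Fintype.card ι) (a : ι → ℝ)
    (h0 : ∑ i, a i = 0) (h2 : ∑ i, a i ^ 2 = 1) {f f' f'' : ℝ → ℝ} {M : ℝ}
    (hf : ∀ x, HasDerivAt f (f' x) x)
    (hM : ∀ w z, |f' z - f' w - f'' w * (z - w)| ≤ M / 2 * (z - w) ^ 2) :
    |∑ S ∈ (univ : Finset ι).powersetCard n, (∑ i ∈ S, a i) * f (∑ i ∈ S, a i) -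
      (n * (Fintype.card ι - n) / (Fintype.card ι * (Fintype.card ι - 1)) : ℝ) *
        ∑ S ∈ (univ : Finset ι).powersetCard n, f' (∑ i ∈ S, a i)| ≤
      (n * (Fintype.card ι - n) / (Fintype.card ι * (Fintype.card ι - 1)) : ℝ) *
      (|∑ S ∈ (univ : Finset ι).powersetCard n, f'' (∑ i ∈ S, a i) * zeroBiasDrift a S| +
        #((univ : Finset ι).powersetCard n) *
          (M / 2 * (∑ i, a i ^ 4 + 5 / Fintype.card ι))) := by
  set s := (n * (Fintype.card ι - n) / (Fintype.card ι * (Fintype.card ι - 1)) : ℝ) with hs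
  set 𝒮 := (univ : Finset ι).powersetCard n with h𝒮
  have hNr : (n : ℝ) < Fintype.card ι := by exact_mod_cast hN
  have hn1 : (1 : ℝ) ≤ n := by exact_mod_cast hn
  have hN0 : (0 : ℝ) < Fintype.card ι := by linarith
  have hs0 : 0 ≤ s := div_nonneg (mul_nonneg (by linarith) (by linarith))
    (mul_nonneg (by linarith) (by linarith))
  have hpt : ∀ S ∈ 𝒮, |1 / 2 * ∑ i, ∑ j, (a i - a j) *
        coupledMean i j (fun R => f (∑ l ∈ R, a l + a i) - f (∑ l ∈ R, a l + a j)) S -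
      Fintype.card ι * (f' (∑ l ∈ S, a l) + f'' (∑ l ∈ S, a l) * zeroBiasDrift a S)| ≤
      M / 2 * (Fintype.card ι * (∑ i, a i ^ 4 + 2 * ((∑ l ∈ S, a l ^ 2) / n) +
      2 * ((1 - ∑ l ∈ S, a l ^ 2) / (Fintype.card ι - n))) + 1) := by
    intro S hS
    obtain ⟨e1, e2⟩ := nonempty_of_mem_powersetCard hn hN hS
    have := abs_sum_coupledMean_sub_le a h0 h2 e1 e2 hf hM
    rw [h𝒮, mem_powersetCard] at hS
    have hc2 : ∑ l ∈ Sᶜ, a l ^ 2 = 1 - ∑ l ∈ S, a l ^ 2 := by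
      have := sum_add_sum_compl S (fun l => a l ^ 2)
      linarith
    rwa [card_compl, hS.2, Nat.cast_sub hN.le, hc2] at this
  have hsum := (abs_sum_le_sum_abs _ _).trans (sum_le_sum hpt)
  have hT2 := sum_subset_sum n hn (fun i => a i ^ 2)
  rw [← h𝒮, h2, mul_one] at hT2
  have e1 := sum_mul_eq_sum_coupledMean n hn hN a h0 f
  rw [← hs, ← h𝒮] at e1
  set X := ∑ S ∈ 𝒮, 1 / 2 * ∑ i, ∑ j, (a i - a j) *
        coupledMean i j (fun R => f (∑ l ∈ R, a l + a i) - f (∑ l ∈ R, a l + a j)) S with hX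
  set T := ∑ S ∈ 𝒮, ∑ l ∈ S, a l ^ 2 with hT
  have hTn : T = n * #𝒮 / Fintype.card ι := by
    rw [eq_div_iff hN0.ne', ← hT2]
    ring
  -- The average of `a²` over `S`, and over its complement, has mean `1/N`. Thus `5/N` is `2/N +
  -- 2/N` from these averages and `1/N` from the additive `1`.
  have hr : ∑ S ∈ 𝒮, M / 2 * (Fintype.card ι * (∑ i, a i ^ 4 + 2 * ((∑ l ∈ S, a l ^ 2) / n) +
      2 * ((1 - ∑ l ∈ S, a l ^ 2) / (Fintype.card ι - n))) + 1) =
      Fintype.card ι * (#𝒮 * (M / 2 * (∑ i, a i ^ 4 + 5 / Fintype.card ι))) := by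
    simp_rw [← mul_sum, sum_add_distrib, ← mul_sum, sum_add_distrib, ← mul_sum, ← sum_div,
      sum_sub_distrib, ← hT, hTn, sum_const, nsmul_eq_mul]
    have : (Fintype.card ι : ℝ) - n ≠ 0 := by linarith
    field_simp
    ring
  rw [hr, sum_sub_distrib, ← hX, ← mul_sum, sum_add_distrib] at hsum
  set Y := ∑ S ∈ 𝒮, (∑ i ∈ S, a i) * f (∑ i ∈ S, a i)
  set F1 := ∑ S ∈ 𝒮, f' (∑ i ∈ S, a i)
  set F2 := ∑ S ∈ 𝒮, f'' (∑ i ∈ S, a i) * zeroBiasDrift a S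
  set Q := #𝒮 * (M / 2 * (∑ i, a i ^ 4 + 5 / (Fintype.card ι : ℝ)))
  have e2 : |Fintype.card ι * (Y - s * F1 - s * F2)| ≤ Fintype.card ι * (s * Q) := by
    have : Fintype.card ι * (Y - s * F1 - s * F2) = s * (X - Fintype.card ι * (F1 + F2)) := by
      rw [mul_sub, mul_sub, e1]
      ring
    rw [this, abs_mul, abs_of_nonneg hs0]
    calc _ ≤ s * (Fintype.card ι * Q) := mul_le_mul_of_nonneg_left hsum hs0
      _ = _ := by ring
  rw [abs_mul, abs_of_pos hN0] at e2
  have e3 := le_of_mul_le_mul_left e2 hN0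
  have e4 : |Y - s * F1| ≤ |Y - s * F1 - s * F2| + |s * F2| := by
    have := abs_add_le (Y - s * F1 - s * F2) (s * F2)
    rwa [sub_add_cancel] at this
  rw [abs_mul s, abs_of_nonneg hs0] at e4
  rw [mul_add]
  linarith

end Combinatorics

/-! ### Comparison with the constants `C₁` and `C₂` -/

/-- `K` is `max(1/n, 1/(N - n))`. Which summand of `C₁²` absorbs `K²` depends on which of `n` and `N
- n` is smaller. -/
theorem sampling_constants_le {N n : ℕ} (hn : 0 < n) (hN : n < N) {p : ℝ} (hp0 : 0 ≤ p)
    (hp1 : p ≤ 1) :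
    ∃ K : ℝ, 1 / (n : ℝ) ≤ K ∧ 1 / (N - n : ℝ) ≤ K ∧
      2 * (n * (N - n) / (N * (N - 1))) * (p + K ^ 2) ≤
      8 * (n * (N - n) / (N * (N - 1)) / (4 * (n : ℝ) ^ 2) + p * srsAlpha N n ^ 2
        + srsBeta N n ^ 2 + srsGamma N n ^ 2 * ((n : ℝ) - 1) ^ 2 + srsEta N n ^ 2) := by
  obtain ⟨m, rfl⟩ := Nat.exists_eq_add_of_lt hN
  have h1 : (1 : ℝ) ≤ n := by exact_mod_cast hn
  set M : ℝ := (m : ℝ) + 1 with hM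
  have hNM : ((n + m + 1 : ℕ) : ℝ) = n + M := by push_cast; ring
  have hM1 : 1 ≤ M := by
    have : (0 : ℝ) ≤ m := Nat.cast_nonneg m
    linarith
  rw [hNM]
  set x : ℝ := (n : ℝ) with hx
  have e : x + M - x = M := by ring
  have hd : 0 < x + M - 1 := by linarith
  have hs1 : x * M / ((x + M) * (x + M - 1)) ≤ 1 / 2 := by
    rw [div_le_div_iff₀ (by positivity) (by norm_num)]
    nlinarith
  have hs0 : 0 ≤ x * M / ((x + M) * (x + M - 1)) := by positivity
  rw [e]
  set s := x * M / ((x + M) * (x + M - 1)) with hs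
  have r1 : 0 ≤ s / (4 * x ^ 2) := by positivity
  have r2 : 0 ≤ p * srsAlpha (x + M) x ^ 2 := by positivity
  have r3 : 0 ≤ srsGamma (x + M) x ^ 2 * (x - 1) ^ 2 := by positivity
  have r4 := sq_nonneg (srsBeta (x + M) x)
  have r5 := sq_nonneg (srsEta (x + M) x)
  -- Here `M = N - n = m + 1`. For `M = 1` the coefficient `α` is close to `0` when `n` is large, so
  -- the `p` term is bounded through `p ≤ 1` and absorbed by the `β`, `γ`, `η` terms.
  rcases Nat.eq_zero_or_pos m with hm | hm
  · have hM' : M = 1 := by simp [hM, hm]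
    refine ⟨1, ?_, by simp [hM'], ?_⟩
    · rw [div_le_one (by linarith)]
      exact h1
    have hse : s = 1 / (x + 1) := by
      have hx0 : x ≠ 0 := by linarith
      rw [hs, hM', add_sub_cancel_right]
      field_simp
    have hA : srsBeta (x + M) x ^ 2 + srsGamma (x + M) x ^ 2 * (x - 1) ^ 2 + srsEta (x + M) x ^ 2 =
        (9 + (x - 1) ^ 2 + (x - 2) ^ 2) / (x + 1) ^ 2 := by
      simp only [srsBeta, srsGamma, srsEta, hM', add_sub_cancel_left]
      field_simp
      ring
    have hB : s ≤ 2 * ((9 + (x - 1) ^ 2 + (x - 2) ^ 2) / (x + 1) ^ 2) := by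
      rw [hse, mul_div_assoc', div_le_div_iff₀ (by positivity) (by positivity)]
      have : x + 1 ≤ 2 * (9 + (x - 1) ^ 2 + (x - 2) ^ 2) := by nlinarith [sq_nonneg (x - 2)]
      nlinarith
    have hC : s * p ≤ s * 1 := mul_le_mul_of_nonneg_left hp1 hs0
    linarith
  · have hM2 : 2 ≤ M := by
      have : (1 : ℝ) ≤ m := by exact_mod_cast hm
      linarith
    have hα : 1 / 4 ≤ srsAlpha (x + M) x ^ 2 := by
      have : (x - 1) / ((x + M) * M) ≤ 1 / 2 := by
        rw [div_le_div_iff₀ (by positivity) (by norm_num)]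
        nlinarith
      simp only [srsAlpha, add_sub_cancel_left]
      nlinarith
    have hD : s * p ≤ 4 * (p * srsAlpha (x + M) x ^ 2) := by
      nlinarith [mul_le_mul_of_nonneg_left hα hp0, mul_le_mul_of_nonneg_right hs1 hp0]
    -- Now `α² ≥ 1/4` takes care of `p`. If `n ≤ M` the term `s / (4 n²)` matches `K²` exactly;
    -- otherwise `N ≥ 5` and `η² ≥ K² / 8`.
    rcases le_or_gt x M with h | h
    · refine ⟨1 / x, le_rfl, one_div_le_one_div_of_le (by linarith) h, ?_⟩
      have : s * (1 / x) ^ 2 = 4 * (s / (4 * x ^ 2)) := by field_simp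
      linarith
    · refine ⟨1 / M, one_div_le_one_div_of_le (by linarith) h.le, le_rfl, ?_⟩
      have hN5 : 5 ≤ x + M := by
        have h3 : m + 1 < n := by
          have : (m : ℝ) + 1 < n := h
          exact_mod_cast this
        have : (3 : ℝ) ≤ n := by exact_mod_cast (by omega : 3 ≤ n)
        linarith
      have hη : s * (1 / M) ^ 2 ≤ 4 * srsEta (x + M) x ^ 2 := by
        have e1 : srsEta (x + M) x ^ 2 = ((x + M - 3) / (x + M)) ^ 2 * (1 / M) ^ 2 := by
          simp only [srsEta, add_sub_cancel_left]
          field_simp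
          ring
        have e2 : 1 / 8 ≤ ((x + M - 3) / (x + M)) ^ 2 := by
          rw [div_pow, div_le_div_iff₀ (by norm_num) (by positivity)]
          nlinarith
        rw [e1, ← mul_assoc]
        exact mul_le_mul_of_nonneg_right (by linarith) (by positivity)
      linarith

open Finset in
theorem powerSum_six_le_one {N : ℕ} {a : Fin N → ℝ} (ha : IsAdmissiblePopulation a) :
    powerSum a 6 ≤ 1 := by
  rw [powerSum, ← ha.sum_sq_eq_one]
  refine sum_le_sum fun i _ => ?_
  have h : a i ^ 2 ≤ 1 := by
    rw [← ha.sum_sq_eq_one]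
    exact single_le_sum (f := fun j => a j ^ 2) (fun _ _ => sq_nonneg _) (mem_univ i)
  have h0 := sq_nonneg (a i)
  have : a i ^ 6 = (a i ^ 2) ^ 3 := by ring
  rw [this]
  calc (a i ^ 2) ^ 3 ≤ (a i ^ 2) ^ 1 := pow_le_pow_of_le_one h0 h (by norm_num)
    _ = _ := pow_one _

theorem powerSum_nonneg {N : ℕ} (a : Fin N → ℝ) {k : ℕ} (hk : Even k) : 0 ≤ powerSum a k :=
  Finset.sum_nonneg fun _ _ => hk.pow_nonneg _

theorem srsC1_nonneg {N : ℕ} (n : ℕ) (a : Fin N → ℝ) : 0 ≤ srsC1 n a := by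
  unfold srsC1
  positivity

/-! ### From ordered samples to averages over subsets -/

section Law

open Finset

theorem card_embedding_image_eq {N n : ℕ} {S : Finset (Fin N)} (hS : #S = n) :
    #{e : Fin n ↪ Fin N | univ.map e = S} = n.factorial := by
  have hc : Fintype.card (Fin n) = Fintype.card S := by simp [hS]
  have : Fintype.card (Fin n ≃ S) = n.factorial := by
    rw [Fintype.card_equiv (Fintype.equivOfCardEq hc)]
    simp
  rw [← this, ← card_univ]
  refine (card_bij (fun (g : Fin n ≃ S) _ => g.toEmbedding.trans (Function.Embedding.subtype _))
    ?_ ?_ ?_).symm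
  · intro g _
    simp only [mem_filter, mem_univ, true_and]
    ext x
    simp only [Finset.mem_map, mem_univ, true_and]
    constructor
    · rintro ⟨i, rfl⟩
      exact (g i).2
    · intro hx
      exact ⟨g.symm ⟨x, hx⟩, by simp⟩
  · intro g _ g' _ h
    ext i
    exact congrArg Fin.val (DFunLike.congr_fun h i)
  · intro e he
    simp only [mem_filter, mem_univ, true_and] at he
    have hm : ∀ i, e i ∈ S := fun i => he ▸ mem_map_of_mem e (mem_univ i)
    refine ⟨Equiv.ofBijective (fun i => ⟨e i, hm i⟩) ?_, mem_univ _, ?_⟩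
    · rw [Fintype.bijective_iff_injective_and_card]
      refine ⟨fun i j h => e.injective ?_, hc⟩
      simpa using h
    · ext i
      rfl

theorem sum_embedding {N n : ℕ} (a : Fin N → ℝ) (F : ℝ → ℝ) :
    ∑ e : Fin n ↪ Fin N, F (∑ i, a (e i)) =
      n.factorial * ∑ S ∈ (univ : Finset (Fin N)).powersetCard n, F (∑ j ∈ S, a j) := by
  have hmaps : ∀ e ∈ (univ : Finset (Fin n ↪ Fin N)),
      univ.map e ∈ (univ : Finset (Fin N)).powersetCard n := by
    intro e _
    simp [mem_powersetCard]
  rw [← sum_fiberwise_of_maps_to hmaps, mul_sum]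
  refine sum_congr rfl fun S hS => ?_
  rw [← card_embedding_image_eq (mem_powersetCard.1 hS).2, ← nsmul_eq_mul, ← sum_const]
  refine sum_congr rfl fun e he => ?_
  rw [← (mem_filter.1 he).2, sum_map]

/-- The sum forgets the order of the sample, and each `n`-subset comes from `n!` orderings. -/
theorem integral_srsLaw {N : ℕ} (n : ℕ) (hn : n ≤ N) (a : Fin N → ℝ) {F : ℝ → ℝ}
    (hF : Measurable F) :
    ∫ x, F (∑ i, x i) ∂(srsLaw n a) =
      (∑ S ∈ (univ : Finset (Fin N)).powersetCard n, F (∑ j ∈ S, a j)) /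
        #((univ : Finset (Fin N)).powersetCard n) := by
  have hm : StronglyMeasurable fun x : Fin n → ℝ => F (∑ i, x i) :=
    (hF.comp (by fun_prop)).stronglyMeasurable
  rw [srsLaw, integral_smul_measure, integral_finsetSum_measure]
  · simp_rw [integral_dirac' _ _ hm]
    rw [sum_embedding, card_powersetCard, card_univ, Fintype.card_fin, smul_eq_mul,
      Nat.descFactorial_eq_factorial_mul_choose]
    have h1 : (n.factorial : ℝ) ≠ 0 := by positivity
    have h2 : (N.choose n : ℝ) ≠ 0 := by exact_mod_cast (Nat.choose_pos hn).ne'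
    simp only [ENNReal.toReal_inv, ENNReal.toReal_natCast]
    push_cast
    field_simp
  · intro e _
    exact integrable_dirac' hm (by simp)

theorem srsSigma_sq {N n : ℕ} (hn : 0 < n) (hN : n < N) {a : Fin N → ℝ}
    (ha : IsAdmissiblePopulation a) :
    srsSigma n a ^ 2 = n * (N - n) / (N * (N - 1)) := by
  have hNr : (n : ℝ) < N := by exact_mod_cast hN
  have hn1 : (1 : ℝ) ≤ n := by exact_mod_cast hn
  have hC : (#((univ : Finset (Fin N)).powersetCard n) : ℝ) ≠ 0 := by
    rw [card_powersetCard, card_univ, Fintype.card_fin]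
    exact_mod_cast (Nat.choose_pos hN.le).ne'
  have e : ∫ x, (∑ i, x i) ^ 2 ∂(srsLaw n a) = n * (N - n) / (N * (N - 1)) := by
    rw [integral_srsLaw n hN.le a (F := fun y => y ^ 2) (by fun_prop),
      sum_sq_subset_sum n hn (by simpa using hN) a ha.sum_eq_zero, ha.sum_sq_eq_one,
      Fintype.card_fin, mul_one, mul_div_cancel_right₀ _ hC]
  rw [srsSigma, e, Real.sq_sqrt]
  exact div_nonneg (mul_nonneg (by linarith) (by linarith))
    (mul_nonneg (by linarith) (by linarith))

theorem srsSigma_pos {N n : ℕ} (hn : 0 < n) (hN : n < N) {a : Fin N → ℝ}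
    (ha : IsAdmissiblePopulation a) : 0 < srsSigma n a := by
  have hNr : (n : ℝ) < N := by exact_mod_cast hN
  have hn1 : (1 : ℝ) ≤ n := by exact_mod_cast hn
  have h := srsSigma_sq hn hN ha
  have : (0 : ℝ) < n * (N - n) / (N * (N - 1)) :=
    div_pos (mul_pos (by linarith) (by linarith)) (mul_pos (by linarith) (by linarith))
  rw [← h] at this
  exact lt_of_le_of_ne (Real.sqrt_nonneg _) fun h0 => by simp [← h0] at this

/-- The mean of the square of the conditional displacement is at most `C₁ ^ 2`. -/
theorem sum_zeroBiasDrift_sq_le_srsC1 {N n : ℕ} (hn : 0 < n) (hN : n < N) {a : Fin N → ℝ}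
    (ha : IsAdmissiblePopulation a) :
    ∑ S ∈ (univ : Finset (Fin N)).powersetCard n, zeroBiasDrift a S ^ 2 ≤
      #((univ : Finset (Fin N)).powersetCard n) * srsC1 n a ^ 2 := by
  obtain ⟨K, h1, h2, h3⟩ := sampling_constants_le hn hN (powerSum_nonneg a (k := 6) (by decide))
    (powerSum_six_le_one ha)
  have h := sum_zeroBiasDrift_sq_le n hn (by simpa using hN) a ha.sum_eq_zero ha.sum_sq_eq_one
    ha.sum_cube_eq_zero h1 (by simpa using h2)
  simp only [Fintype.card_fin] at h
  refine h.trans (mul_le_mul_of_nonneg_left ?_ (Nat.cast_nonneg _))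
  rw [srsC1, mul_pow, Real.sq_sqrt (by norm_num), Real.sq_sqrt, srsSigma_sq hn hN ha]
  · exact h3
  · have := powerSum_nonneg a (k := 6) (by decide)
    positivity

/-- Cauchy–Schwarz passes from the second moment of the drift to its first absolute moment. -/
theorem abs_sum_mul_zeroBiasDrift_le {N n : ℕ} (hn : 0 < n) (hN : n < N) {a : Fin N → ℝ}
    (ha : IsAdmissiblePopulation a) {g : ℝ → ℝ} {M : ℝ} (hg : ∀ x, |g x| ≤ M) :
    |∑ S ∈ (univ : Finset (Fin N)).powersetCard n, g (∑ i ∈ S, a i) * zeroBiasDrift a S| ≤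
      #((univ : Finset (Fin N)).powersetCard n) * (M * srsC1 n a) := by
  have hM : 0 ≤ M := (abs_nonneg _).trans (hg 0)
  have h1 : ∑ S ∈ (univ : Finset (Fin N)).powersetCard n, |zeroBiasDrift a S| ≤
      #((univ : Finset (Fin N)).powersetCard n) * srsC1 n a := by
    refine abs_le_of_sq_le_sq' ?_ (mul_nonneg (Nat.cast_nonneg _) (srsC1_nonneg _ _)) |>.2
    have h2 := sq_sum_le_card_mul_sum_sq (s := (univ : Finset (Fin N)).powersetCard n)
      (f := fun S => |zeroBiasDrift a S|)
    simp only [sq_abs] at h2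
    refine h2.trans ?_
    rw [mul_pow, sq (_ : ℝ), mul_assoc]
    exact mul_le_mul_of_nonneg_left (sum_zeroBiasDrift_sq_le_srsC1 hn hN ha) (Nat.cast_nonneg _)
  calc _ ≤ ∑ S ∈ (univ : Finset (Fin N)).powersetCard n, M * |zeroBiasDrift a S| := by
        refine (abs_sum_le_sum_abs _ _).trans (sum_le_sum fun S _ => ?_)
        rw [abs_mul]
        exact mul_le_mul_of_nonneg_right (hg _) (abs_nonneg _)
    _ ≤ _ := by
        rw [← mul_sum, mul_left_comm]
        exact mul_le_mul_of_nonneg_left h1 hM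

theorem powerSum_four_add_le_srsC2 {N : ℕ} (a : Fin N → ℝ) :
    powerSum a 4 + 5 / (N : ℝ) ≤ srsC2 a := by
  have h := powerSum_nonneg a (k := 4) (by decide)
  have h2 : 5 / (N : ℝ) ≤ 45 / N := by gcongr; norm_num
  unfold srsC2
  linarith

/-- The zero bias estimate for a simple random sample from an admissible population. -/
theorem abs_sum_mul_sub_le_srs {N n : ℕ} (hn : 0 < n) (hN : n < N) {a : Fin N → ℝ}
    (ha : IsAdmissiblePopulation a) {f f' f'' : ℝ → ℝ} {M₂ M₃ : ℝ}
    (hf : ∀ x, HasDerivAt f (f' x) x) (h2 : ∀ x, |f'' x| ≤ M₂)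
    (h3 : ∀ w z, |f' z - f' w - f'' w * (z - w)| ≤ M₃ / 2 * (z - w) ^ 2) :
    |∑ S ∈ (univ : Finset (Fin N)).powersetCard n, (∑ i ∈ S, a i) * f (∑ i ∈ S, a i) -
      srsSigma n a ^ 2 * ∑ S ∈ (univ : Finset (Fin N)).powersetCard n, f' (∑ i ∈ S, a i)| ≤
      #((univ : Finset (Fin N)).powersetCard n) *
        (srsSigma n a ^ 2 * (M₂ * srsC1 n a + M₃ / 2 * srsC2 a)) := by
  have hM3 : 0 ≤ M₃ := by
    have := (abs_nonneg _).trans (h3 0 1)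
    simp at this; linarith
  have h := abs_sum_mul_sub_le n hn (by simpa using hN) a ha.sum_eq_zero ha.sum_sq_eq_one hf h3
  simp only [Fintype.card_fin] at h
  rw [← srsSigma_sq hn hN ha] at h
  refine (h.trans (mul_le_mul_of_nonneg_left ?_ (sq_nonneg _))).trans_eq
    (mul_left_comm (srsSigma n a ^ 2) _ _)
  rw [mul_add _ (M₂ * srsC1 n a)]
  exact add_le_add (abs_sum_mul_zeroBiasDrift_le hn hN ha h2)
    (mul_le_mul_of_nonneg_left (mul_le_mul_of_nonneg_left (powerSum_four_add_le_srsC2 a)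
      (by positivity)) (Nat.cast_nonneg _))

end Law

/-! ### Taylor remainder from a Lipschitz condition -/

theorem abs_sub_sub_mul_le {g g' : ℝ → ℝ} (hg : ∀ x, HasDerivAt g (g' x) x) {M : ℝ} (w : ℝ)
    (h : ∀ x, |g' x - g' w| ≤ M * |x - w|) (z : ℝ) :
    |g z - g w - g' w * (z - w)| ≤ M / 2 * (z - w) ^ 2 := by
  have key : ∀ (k k' : ℝ → ℝ) (w : ℝ), (∀ x, HasDerivAt k (k' x) x) →
      (∀ x, |k' x - k' w| ≤ M * |x - w|) → ∀ z, w ≤ z →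
      |k z - k w - k' w * (z - w)| ≤ M / 2 * (z - w) ^ 2 := by
    intro k k' w hk h z hz
    have hd : ∀ x, HasDerivAt (fun x => k x - k w - k' w * (x - w)) (k' x - k' w) x := by
      intro x
      refine (((hk x).sub_const (k w)).sub
        (((hasDerivAt_id x).sub_const w).const_mul (k' w))).congr_deriv ?_
      simp
    have hB : ∀ x, HasDerivAt (fun x => M / 2 * (x - w) ^ 2) (M * (x - w)) x := by
      intro x
      refine ((((hasDerivAt_id x).sub_const w).pow 2).const_mul (M / 2)).congr_deriv ?_
      simp; ring
    refine image_norm_le_of_norm_deriv_right_le_deriv_boundary' (a := w) (b := z)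
      (f := fun x => k x - k w - k' w * (x - w)) (B := fun x => M / 2 * (x - w) ^ 2)
      (fun x _ => (hd x).continuousAt.continuousWithinAt) (fun x _ => (hd x).hasDerivWithinAt)
      (by simp) (fun x _ => (hB x).continuousAt.continuousWithinAt)
      (fun x _ => (hB x).hasDerivWithinAt) (fun x hx => ?_) (Set.right_mem_Icc.2 hz)
    have := h x
    rwa [abs_of_nonneg (sub_nonneg.2 hx.1)] at this
  rcases le_total w z with hz | hz
  · exact key g g' w hg h z hz
  -- The case to the left of `w` follows by reflecting the line.
  · have := key (fun x => g (-x)) (fun x => -g' (-x)) (-w)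
      (fun x => ((hg (-x)).scomp x (hasDerivAt_neg x)).congr_deriv (by simp))
      (fun x => by
        have := h (-x)
        rw [← abs_neg] at this
        convert this using 1
        · congr 1
          simp; ring
        · congr 1
          rw [← abs_neg]
          congr 1
          ring) (-z) (neg_le_neg hz)
    simp only [neg_neg] at this
    convert this using 1
    · congr 1
      ring
    · ring

/-! ### Gaussian integration by parts and the rotation path -/

section Gaussian

/-- Integration by parts against the density `φ`, using `φ'(x) = -x φ(x)`. -/
theorem integral_gaussianReal_mul_eq_integral_deriv {g g' : ℝ → ℝ}
    (hg : ∀ x, HasDerivAt g (g' x) x) {A B : ℝ} (hA : ∀ x, |g x| ≤ A) (hB : ∀ x, |g' x| ≤ B) :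
    ∫ z, z * g z ∂(gaussianReal 0 1) = ∫ z, g' z ∂(gaussianReal 0 1) := by
  have hgd : Differentiable ℝ g := fun x => (hg x).differentiableAt
  have hg'm : Measurable g' := by
    have : g' = deriv g := funext fun x => (hg x).deriv.symm
    rw [this]
    exact measurable_deriv g
  have hφ : ∀ x, HasDerivAt (gaussianPDFReal 0 1) (-(x * gaussianPDFReal 0 1 x)) x := by
    intro x
    rw [gaussianPDFReal_def]
    have h1 : HasDerivAt (fun x : ℝ => -(x - 0) ^ 2 / (2 * ((1 : NNReal) : ℝ))) (-x) x := by
      refine (((((hasDerivAt_id x).sub_const 0).pow 2).neg).div_const _).congr_deriv ?_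
      simp
      ring
    refine (h1.exp.const_mul _).congr_deriv ?_
    ring
  have i1 : Integrable (fun x : ℝ => x * gaussianPDFReal 0 1 x) := by
    rw [gaussianPDFReal_def]
    have := (integrable_mul_exp_neg_mul_sq (b := 1 / 2) (by norm_num)).const_mul
      (√(2 * Real.pi * (1 : NNReal)))⁻¹
    refine this.congr (ae_of_all _ fun x => ?_)
    simp only
    have : -(1 / 2) * x ^ 2 = -(x - 0) ^ 2 / (2 * ((1 : NNReal) : ℝ)) := by
      simp; ring
    rw [this]
    ring
  have h := integral_mul_deriv_eq_deriv_mul_of_integrable (u := g) (u' := g')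
    (v := gaussianPDFReal 0 1) (v' := fun x => -(x * gaussianPDFReal 0 1 x))
    (fun x _ => hg x) (fun x _ => hφ x)
    (i1.neg.bdd_mul hgd.continuous.aestronglyMeasurable (ae_of_all _ hA))
    ((integrable_gaussianPDFReal 0 1).bdd_mul hg'm.aestronglyMeasurable (ae_of_all _ hB))
    ((integrable_gaussianPDFReal 0 1).bdd_mul hgd.continuous.aestronglyMeasurable (ae_of_all _ hA))
  rw [integral_gaussianReal_eq_integral_smul one_ne_zero,
    integral_gaussianReal_eq_integral_smul one_ne_zero]
  simp only [smul_eq_mul]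
  have e1 : ∫ x, gaussianPDFReal 0 1 x * (x * g x) =
      -∫ x, g x * -(x * gaussianPDFReal 0 1 x) := by
    rw [← integral_neg]
    exact integral_congr_ae (ae_of_all _ fun x => by ring)
  rw [e1, h, neg_neg]
  exact integral_congr_ae (ae_of_all _ fun x => by ring)

theorem integrable_id_gaussianReal : Integrable (fun z : ℝ => z) (gaussianReal 0 1) :=
  memLp_one_iff_integrable.1 (memLp_id_gaussianReal 1)

theorem integrable_comp_gaussianReal {h : ℝ → ℝ} (hc : Continuous h) {A : ℝ}
    (hA : ∀ x, |h x| ≤ A) (u v : ℝ) :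
    Integrable (fun z => h (u + v * z)) (gaussianReal 0 1) := by
  refine (integrable_const A).mono' ?_ (ae_of_all _ fun z => hA _)
  exact (hc.comp (by fun_prop)).aestronglyMeasurable

/-- Differentiation under the integral produces a term `-sin θ · z h₁`; integrating by parts in `z`
replaces it by `-sin θ cos θ · h₂`, so that the derivative has the shape `w g(w) - g'(w)`. -/
theorem hasDerivAt_rotation {h h₁ h₂ : ℝ → ℝ} (d0 : ∀ x, HasDerivAt h (h₁ x) x)
    (d1 : ∀ x, HasDerivAt h₁ (h₂ x) x) {A₁ A₂ : ℝ} (b1 : ∀ x, |h₁ x| ≤ A₁)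
    (b2 : ∀ x, |h₂ x| ≤ A₂) (w θ : ℝ) :
    HasDerivAt (fun θ => ∫ z, h (Real.sin θ * w + Real.cos θ * z) ∂(gaussianReal 0 1))
      (∫ z, (Real.cos θ * (w * h₁ (Real.sin θ * w + Real.cos θ * z)) -
        Real.cos θ * (Real.sin θ * h₂ (Real.sin θ * w + Real.cos θ * z)))
          ∂(gaussianReal 0 1)) θ := by
  have hc : Continuous h := continuous_iff_continuousAt.2 fun x => (d0 x).continuousAt
  have hc1 : Continuous h₁ := continuous_iff_continuousAt.2 fun x => (d1 x).continuousAt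
  have hA1 : 0 ≤ A₁ := (abs_nonneg _).trans (b1 0)
  -- `h` itself may be unbounded; linear growth is enough for Gaussian integrability.
  have hlip : ∀ x, |h x| ≤ |h 0| + A₁ * |x| := by
    intro x
    have := Convex.norm_image_sub_le_of_norm_hasDerivWithin_le (s := Set.univ) (f := h) (f' := h₁)
      (C := A₁) (fun x _ => (d0 x).hasDerivWithinAt) (fun x _ => b1 x) convex_univ
      (Set.mem_univ 0) (Set.mem_univ x)
    simp only [Real.norm_eq_abs, sub_zero] at this
    have h2 := abs_add_le (h x - h 0) (h 0)
    rw [sub_add_cancel] at h2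
    linarith
  have ibound : Integrable (fun z : ℝ => (|w| + |z|) * A₁) (gaussianReal 0 1) :=
    ((integrable_const _).add integrable_id_gaussianReal.abs).mul_const _
  have hmain := (hasDerivAt_integral_of_dominated_loc_of_deriv_le (μ := gaussianReal 0 1)
    (x₀ := θ) (s := Set.univ) (F := fun θ z => h (Real.sin θ * w + Real.cos θ * z))
    (F' := fun θ z => (Real.cos θ * w + -Real.sin θ * z) *
      h₁ (Real.sin θ * w + Real.cos θ * z)) (bound := fun z => (|w| + |z|) * A₁)
    Filter.univ_mem
    (Eventually.of_forall fun θ => (hc.comp (by fun_prop)).aestronglyMeasurable)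
    ?_ ?_ ?_ ibound ?_).2
  · refine hmain.congr_deriv ?_
    have i0 : Integrable (fun z => Real.cos θ * (w * h₁ (Real.sin θ * w + Real.cos θ * z)))
        (gaussianReal 0 1) :=
      ((integrable_comp_gaussianReal hc1 b1 _ _).const_mul w).const_mul _
    have i1 : Integrable (fun z => z * h₁ (Real.sin θ * w + Real.cos θ * z))
        (gaussianReal 0 1) :=
      integrable_id_gaussianReal.mul_bdd
        (hc1.comp (by fun_prop)).aestronglyMeasurable (ae_of_all _ fun z => b1 _)
    have hh2m : Measurable h₂ := by
      have : h₂ = deriv h₁ := funext fun x => (d1 x).deriv.symm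
      rw [this]
      exact measurable_deriv h₁
    have i2 : Integrable (fun z => h₂ (Real.sin θ * w + Real.cos θ * z)) (gaussianReal 0 1) :=
      (integrable_const A₂).mono' (hh2m.comp (by fun_prop)).aestronglyMeasurable
        (ae_of_all _ fun z => b2 _)
    have hst := integral_gaussianReal_mul_eq_integral_deriv
      (g := fun z => h₁ (Real.sin θ * w + Real.cos θ * z))
      (g' := fun z => Real.cos θ * h₂ (Real.sin θ * w + Real.cos θ * z)) (A := A₁)
      (B := |Real.cos θ| * A₂)
      (fun z => by
        have e : HasDerivAt (fun z => Real.sin θ * w + Real.cos θ * z) (Real.cos θ) z := by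
          simpa using ((hasDerivAt_id z).const_mul (Real.cos θ)).const_add (Real.sin θ * w)
        exact ((d1 _).comp z e).congr_deriv (mul_comm _ _))
      (fun z => b1 _)
      (fun z => by
        rw [abs_mul]
        exact mul_le_mul_of_nonneg_left (b2 _) (abs_nonneg _))
    rw [integral_sub i0 ((i2.const_mul _).const_mul _)]
    have e1 : ∫ z, (Real.cos θ * w + -Real.sin θ * z) * h₁ (Real.sin θ * w + Real.cos θ * z)
        ∂(gaussianReal 0 1) =
        ∫ z, Real.cos θ * (w * h₁ (Real.sin θ * w + Real.cos θ * z)) ∂(gaussianReal 0 1) -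
        ∫ z, Real.sin θ * (z * h₁ (Real.sin θ * w + Real.cos θ * z)) ∂(gaussianReal 0 1) := by
      rw [← integral_sub i0 (i1.const_mul _)]
      exact integral_congr_ae (ae_of_all _ fun z => by ring)
    have e2 : ∫ z, Real.cos θ * (Real.sin θ * h₂ (Real.sin θ * w + Real.cos θ * z))
        ∂(gaussianReal 0 1) = Real.cos θ * (Real.sin θ *
          ∫ z, h₂ (Real.sin θ * w + Real.cos θ * z) ∂(gaussianReal 0 1)) := by
      rw [integral_const_mul, integral_const_mul]
    rw [integral_const_mul] at hst
    rw [e1, e2, integral_const_mul (Real.sin θ), hst]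
    ring
  · have : Integrable (fun z : ℝ => |h 0| + A₁ * (|Real.sin θ * w| + |Real.cos θ| * |z|))
        (gaussianReal 0 1) :=
      (integrable_const _).add (((integrable_const _).add
        (integrable_id_gaussianReal.abs.const_mul _)).const_mul _)
    refine this.mono' (hc.comp (by fun_prop)).aestronglyMeasurable (ae_of_all _ fun z => ?_)
    refine (hlip _).trans ?_
    gcongr
    rw [← abs_mul]
    exact abs_add_le _ _
  · exact ((by fun_prop : Continuous fun z : ℝ => Real.cos θ * w + -Real.sin θ * z).mul
      (hc1.comp (by fun_prop))).aestronglyMeasurable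
  · refine ae_of_all _ fun z t _ => ?_
    rw [norm_mul]
    refine mul_le_mul ?_ (b1 _) (norm_nonneg _) (by positivity)
    refine (norm_add_le _ _).trans ?_
    rw [norm_mul, norm_mul, norm_neg]
    refine add_le_add ?_ ?_
    · exact mul_le_of_le_one_left (abs_nonneg _) (Real.abs_cos_le_one t)
    · exact mul_le_of_le_one_left (abs_nonneg _) (Real.abs_sin_le_one t)
  · refine ae_of_all _ fun z t _ => ?_
    have e : HasDerivAt (fun t => Real.sin t * w + Real.cos t * z)
        (Real.cos t * w + -Real.sin t * z) t :=
      ((Real.hasDerivAt_sin t).mul_const w).add ((Real.hasDerivAt_cos t).mul_const z)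
    exact ((d0 _).comp t e).congr_deriv (mul_comm _ _)

end Gaussian

/-! ### Comparison with the normal law along the rotation -/

section Comparison

open Finset

theorem abs_average_sub_integral_le {N n : ℕ} (hn : 0 < n) (hN : n < N) {a : Fin N → ℝ}
    (ha : IsAdmissiblePopulation a) {h h₁ h₂ h₃ : ℝ → ℝ} (d0 : ∀ x, HasDerivAt h (h₁ x) x)
    (d1 : ∀ x, HasDerivAt h₁ (h₂ x) x) (d2 : ∀ x, HasDerivAt h₂ (h₃ x) x) {A₁ A₂ A₃ A₄ : ℝ}
    (b1 : ∀ x, |h₁ x| ≤ A₁) (b2 : ∀ x, |h₂ x| ≤ A₂) (b3 : ∀ x, |h₃ x| ≤ A₃)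
    (b4 : ∀ x y, |h₃ x - h₃ y| ≤ A₄ * |x - y|) :
    |(∑ S ∈ (univ : Finset (Fin N)).powersetCard n, h ((∑ j ∈ S, a j) / srsSigma n a)) /
        #((univ : Finset (Fin N)).powersetCard n) - ∫ z, h z ∂(gaussianReal 0 1)| ≤
      1 / (3 * srsSigma n a) * srsC1 n a * A₃ + 1 / (8 * srsSigma n a ^ 2) * srsC2 a * A₄ := by
  set σ := srsSigma n a with hσ
  have hσ0 : 0 < σ := srsSigma_pos hn hN ha
  set 𝒮 := (univ : Finset (Fin N)).powersetCard n with h𝒮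
  have hC : (0 : ℝ) < #𝒮 := by
    rw [h𝒮, card_powersetCard, card_univ, Fintype.card_fin]
    exact_mod_cast Nat.choose_pos hN.le
  have hc1 : Continuous h₁ := continuous_iff_continuousAt.2 fun x => (d1 x).continuousAt
  have hc2 : Continuous h₂ := continuous_iff_continuousAt.2 fun x => (d2 x).continuousAt
  set ψ : ℝ → ℝ := fun θ => ∑ S ∈ 𝒮, ∫ z, h (Real.sin θ * ((∑ j ∈ S, a j) / σ) + Real.cos θ * z)
    ∂(gaussianReal 0 1) with hψ
  set ψ' : ℝ → ℝ := fun θ => ∑ S ∈ 𝒮, ∫ z, (Real.cos θ * ((∑ j ∈ S, a j) / σ *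
      h₁ (Real.sin θ * ((∑ j ∈ S, a j) / σ) + Real.cos θ * z)) - Real.cos θ * (Real.sin θ *
        h₂ (Real.sin θ * ((∑ j ∈ S, a j) / σ) + Real.cos θ * z))) ∂(gaussianReal 0 1) with hψ'
  have hd : ∀ θ, HasDerivAt ψ (ψ' θ) θ := fun θ =>
    HasDerivAt.fun_sum fun S _ => hasDerivAt_rotation d0 d1 b1 b2 _ θ
  -- For each fixed `z` the zero bias estimate is applied to `w ↦ h₁ (s * w + cos θ * z)` with `s =
  -- sin θ / σ`. Its first derivative brings out one factor `s`, its second `s ^ 2`, and the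
  -- Lipschitz constant of the latter `s ^ 3`.
  have hbound : ∀ θ, 0 ≤ Real.sin θ → 0 ≤ Real.cos θ →
      |ψ' θ| ≤ #𝒮 * (Real.cos θ * (Real.sin θ ^ 2 * (1 / σ * srsC1 n a * A₃) +
        Real.sin θ ^ 3 * (1 / (2 * σ ^ 2) * srsC2 a * A₄))) := by
    intro θ hs hc
    set s := Real.sin θ / σ with hsdef
    have hs0 : 0 ≤ s := div_nonneg hs hσ0.le
    have e1 : ψ' θ = ∫ z, Real.cos θ / σ * (∑ S ∈ 𝒮, (∑ j ∈ S, a j) *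
        h₁ (s * (∑ j ∈ S, a j) + Real.cos θ * z) -
        σ ^ 2 * ∑ S ∈ 𝒮, s * h₂ (s * (∑ j ∈ S, a j) + Real.cos θ * z)) ∂(gaussianReal 0 1) := by
      rw [hψ']
      beta_reduce
      rw [← integral_finsetSum]
      · refine integral_congr_ae (ae_of_all _ fun z => ?_)
        simp only
        rw [mul_sum, ← sum_sub_distrib, mul_sum]
        refine sum_congr rfl fun S _ => ?_
        have : Real.sin θ * ((∑ j ∈ S, a j) / σ) = s * ∑ j ∈ S, a j := by
          rw [hsdef]
          ring
        rw [this, hsdef]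
        field_simp
      · intro S _
        exact (((integrable_comp_gaussianReal hc1 b1 _ _).const_mul _).const_mul _).sub
          (((integrable_comp_gaussianReal hc2 b2 _ _).const_mul _).const_mul _)
    have e2 : ∀ z, ‖Real.cos θ / σ * (∑ S ∈ 𝒮, (∑ j ∈ S, a j) *
        h₁ (s * (∑ j ∈ S, a j) + Real.cos θ * z) -
        σ ^ 2 * ∑ S ∈ 𝒮, s * h₂ (s * (∑ j ∈ S, a j) + Real.cos θ * z))‖ ≤
        Real.cos θ / σ * (#𝒮 * (σ ^ 2 * (s ^ 2 * A₃ * srsC1 n a +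
          s ^ 3 * A₄ / 2 * srsC2 a))) := by
      intro z
      rw [norm_mul, Real.norm_of_nonneg (div_nonneg hc hσ0.le)]
      refine mul_le_mul_of_nonneg_left ?_ (div_nonneg hc hσ0.le)
      have hlin : ∀ w, HasDerivAt (fun w => s * w + Real.cos θ * z) s w := fun w => by
        simpa using ((hasDerivAt_id w).const_mul s).add_const (Real.cos θ * z)
      refine abs_sum_mul_sub_le_srs hn hN ha (f := fun w => h₁ (s * w + Real.cos θ * z))
        (f' := fun w => s * h₂ (s * w + Real.cos θ * z))
        (f'' := fun w => s ^ 2 * h₃ (s * w + Real.cos θ * z)) ?_ ?_ ?_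
      · intro w
        exact ((d1 _).comp w (hlin w)).congr_deriv (mul_comm _ _)
      · intro w
        rw [abs_mul, abs_of_nonneg (sq_nonneg s)]
        exact mul_le_mul_of_nonneg_left (b3 _) (sq_nonneg s)
      · intro w t
        have := mul_le_mul_of_nonneg_left (abs_sub_sub_mul_le d2 (s * w + Real.cos θ * z)
          (fun x => b4 x _) (s * t + Real.cos θ * z)) hs0
        rw [← abs_of_nonneg hs0, ← abs_mul, abs_of_nonneg hs0] at this
        refine (le_of_eq ?_).trans (this.trans (le_of_eq ?_))
        · congr 1
          ring
        · ring
    rw [e1]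
    refine (norm_integral_le_of_norm_le_const (ae_of_all _ e2)).trans (le_of_eq ?_)
    rw [probReal_univ, mul_one, hsdef]
    field_simp
  -- An explicit primitive of the bound, zero at `0`; its value at `π / 2` supplies `1/3` and `1/4 ·
  -- 1/2 = 1/8`.
  have hB : ∀ θ, HasDerivAt (fun θ => #𝒮 * (Real.sin θ ^ 3 / 3 * (1 / σ * srsC1 n a * A₃) +
        Real.sin θ ^ 4 / 4 * (1 / (2 * σ ^ 2) * srsC2 a * A₄)))
      (#𝒮 * (Real.cos θ * (Real.sin θ ^ 2 * (1 / σ * srsC1 n a * A₃) +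
        Real.sin θ ^ 3 * (1 / (2 * σ ^ 2) * srsC2 a * A₄)))) θ := by
    intro θ
    refine ((((((Real.hasDerivAt_sin θ).pow 3).div_const 3).mul_const _).add
      ((((Real.hasDerivAt_sin θ).pow 4).div_const 4).mul_const _)).const_mul (#𝒮 : ℝ)).congr_deriv ?_
    push_cast
    ring
  have hfin := image_norm_le_of_norm_deriv_right_le_deriv_boundary' (a := 0) (b := Real.pi / 2)
    (f := fun θ => ψ θ - ψ 0)
    (fun x _ => ((hd x).sub_const _).continuousAt.continuousWithinAt)
    (fun x _ => ((hd x).sub_const _).hasDerivWithinAt) (by simp)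
    (fun x _ => (hB x).continuousAt.continuousWithinAt)
    (fun x _ => (hB x).hasDerivWithinAt)
    (fun x hx => hbound x (Real.sin_nonneg_of_nonneg_of_le_pi hx.1 (by linarith [hx.2, Real.pi_pos]))
      (Real.cos_nonneg_of_neg_pi_div_two_le_of_le (by linarith [hx.1, Real.pi_pos]) hx.2.le))
    (Set.right_mem_Icc.2 (by positivity))
  have p0 : ψ 0 = #𝒮 * ∫ z, h z ∂(gaussianReal 0 1) := by
    simp [hψ]
  have p1 : ψ (Real.pi / 2) = ∑ S ∈ 𝒮, h ((∑ j ∈ S, a j) / σ) := by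
    simp [hψ]
  simp only [p0, p1, Real.sin_pi_div_two, Real.norm_eq_abs] at hfin
  have e3 : (∑ S ∈ 𝒮, h ((∑ j ∈ S, a j) / σ)) / #𝒮 - ∫ z, h z ∂(gaussianReal 0 1) =
      (∑ S ∈ 𝒮, h ((∑ j ∈ S, a j) / σ) - #𝒮 * ∫ z, h z ∂(gaussianReal 0 1)) / #𝒮 := by
    field_simp
  rw [e3, abs_div, abs_of_pos hC, div_le_iff₀ hC]
  refine hfin.trans (le_of_eq ?_)
  field_simp
  ring

theorem HasFourBoundedDerivs.abs_le_supNorm {h : ℝ → ℝ} (hh : HasFourBoundedDerivs h) {k : ℕ}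
    (h1 : 1 ≤ k) (h4 : k ≤ 4) (x : ℝ) : |iteratedDeriv k h x| ≤ supNorm (iteratedDeriv k h) := by
  obtain ⟨M, hM⟩ := hh.bounded k h1 h4
  exact le_ciSup (f := fun x => |iteratedDeriv k h x|) ⟨M, by rintro _ ⟨y, rfl⟩; exact hM y⟩ x

theorem HasFourBoundedDerivs.hasDerivAt {h : ℝ → ℝ} (hh : HasFourBoundedDerivs h) {k : ℕ}
    (hk : k < 4) (x : ℝ) : HasDerivAt (iteratedDeriv k h) (iteratedDeriv (k + 1) h x) x := by
  rw [iteratedDeriv_succ]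
  exact (hh.differentiable k hk x).hasDerivAt

theorem supNorm_nonneg (g : ℝ → ℝ) : 0 ≤ supNorm g := Real.iSup_nonneg fun _ => abs_nonneg _

theorem normalError_srs_le {N n : ℕ} (hn : 0 < n) (hN : n < N) {a : Fin N → ℝ}
    (ha : IsAdmissiblePopulation a) {Ω : Type*} [MeasurableSpace Ω] {P : Measure Ω}
    {X : Fin n → Ω → ℝ} (hX : HasLaw (fun ω i => X i ω) (srsLaw n a) P)
    {h : ℝ → ℝ} (hh : HasFourBoundedDerivs h) :
    normalError P (fun ω => ∑ i, X i ω) (srsSigma n a) h ≤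
      1 / (3 * srsSigma n a) * srsC1 n a * supNorm (iteratedDeriv 3 h)
        + 1 / (8 * srsSigma n a ^ 2) * srsC2 a * supNorm (iteratedDeriv 4 h) := by
  have d0 : ∀ x, HasDerivAt h (iteratedDeriv 1 h x) x := fun x => by
    simpa using hh.hasDerivAt (k := 0) (by norm_num) x
  have hm : Measurable fun y => h (y / srsSigma n a) := by
    have : Continuous h := continuous_iff_continuousAt.2 fun x => (d0 x).continuousAt
    exact this.measurable.comp (by fun_prop)
  have e : ∫ ω, h ((∑ i, X i ω) / srsSigma n a) ∂P =
      ∫ x, h ((∑ i, x i) / srsSigma n a) ∂(srsLaw n a) :=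
    hX.integral_comp (f := fun x : Fin n → ℝ => h ((∑ i, x i) / srsSigma n a))
      (hm.comp (by fun_prop : Measurable fun x : Fin n → ℝ => ∑ i, x i)).aestronglyMeasurable
  rw [normalError, e, integral_srsLaw n hN.le a (F := fun y => h (y / srsSigma n a)) hm]
  refine abs_average_sub_integral_le hn hN ha d0 (hh.hasDerivAt (by norm_num))
    (hh.hasDerivAt (by norm_num)) (hh.abs_le_supNorm (by norm_num) (by norm_num))
    (hh.abs_le_supNorm (by norm_num) (by norm_num)) (hh.abs_le_supNorm (by norm_num) (by norm_num))
    fun x y => ?_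
  exact Convex.norm_image_sub_le_of_norm_hasDerivWithin_le (s := Set.univ)
    (fun x _ => (hh.hasDerivAt (by norm_num) x).hasDerivWithinAt)
    (fun x _ => hh.abs_le_supNorm (by norm_num) (by norm_num) x) convex_univ
    (Set.mem_univ y) (Set.mem_univ x)

end Comparison

/-! ### Limiting constants and uniformity of the error -/

section Asymptotics

/-- The largest ratio of a summand under the root in `n * C₁` to the matching summand in `B₁`. -/
noncomputable def srsSummandRatio (f N n : ℝ) : ℝ :=
  max (max (n * (N - n) / (N * (N - 1)) / (f * (1 - f))) (srsAlpha N n ^ 2))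
    (((n * srsBeta N n) ^ 2 + (n * (srsGamma N n * (n - 1))) ^ 2 + (n * srsEta N n) ^ 2) /
      (2 * (f / (1 - f)) ^ 2))

/-- An upper bound for the ratio of `n * C₁ / (3 * σ)` to `B₁`. -/
noncomputable def srsRatio₁ (f N n : ℝ) : ℝ :=
  √(srsSummandRatio f N n) * √(f * (1 - f)) / √(n * (N - n) / (N * (N - 1)))

/-- An upper bound for the ratio of `n * C₂ / (8 * σ ^ 2)` to `B₂`. -/
noncomputable def srsRatio₂ (f N n : ℝ) : ℝ :=
  max 1 (n / N / f) * (f * (1 - f)) / (n * (N - n) / (N * (N - 1)))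

theorem srsB1_nonneg {N : ℕ} (f : ℝ) (n : ℕ) (a : Fin N → ℝ) : 0 ≤ srsB1 f n a := by
  unfold srsB1
  positivity

theorem srsB2_nonneg {N : ℕ} {f : ℝ} (hf0 : 0 < f) (hf1 : f < 1) (n : ℕ) (a : Fin N → ℝ) :
    0 ≤ srsB2 f n a := by
  have := powerSum_nonneg a (k := 4) (by decide)
  have := sub_pos.2 hf1
  unfold srsB2
  positivity

/-- Comparing the sums under the two roots summand by summand, with `β`, `γ`, `η` grouped against `2
(f/(1 - f))²`, gives a factor free of the population. -/
theorem mul_srsC1_le {N n : ℕ} (hn : 0 < n) (hN : n < N) {f : ℝ} (hf0 : 0 < f) (hf1 : f < 1)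
    {a : Fin N → ℝ} (ha : IsAdmissiblePopulation a) :
    n * (1 / (3 * srsSigma n a) * srsC1 n a) ≤ srsB1 f n a * srsRatio₁ f N n := by
  have hσ := srsSigma_pos hn hN ha
  have hσ2 := srsSigma_sq hn hN ha
  have hσs : √(n * (N - n) / (N * (N - 1)) : ℝ) = srsSigma n a := by
    rw [← hσ2, Real.sqrt_sq hσ.le]
  have hf := sub_pos.2 hf1
  have hp := powerSum_nonneg a (k := 6) (by decide)
  set ρ := srsSummandRatio f N n with hρ
  have r1 : srsSigma n a ^ 2 ≤ ρ * (f * (1 - f)) := by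
    rw [← div_le_iff₀ (by positivity), hσ2]
    exact (le_max_left _ _).trans (le_max_left _ _)
  have r2 : srsAlpha N n ^ 2 ≤ ρ := (le_max_right _ _).trans (le_max_left _ _)
  have r3 : (n * srsBeta N n) ^ 2 + (n * (srsGamma N n * (n - 1))) ^ 2 + (n * srsEta N n) ^ 2 ≤
      ρ * (2 * (f / (1 - f)) ^ 2) := by
    rw [← div_le_iff₀ (by positivity)]
    exact le_max_right _ _
  have hn0 : (0 : ℝ) < n := by exact_mod_cast hn
  have hρ0 : 0 ≤ ρ := (sq_nonneg _).trans r2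
  have key : n * √(srsSigma n a ^ 2 / (4 * (n : ℝ) ^ 2) + powerSum a 6 * srsAlpha N n ^ 2
      + srsBeta N n ^ 2 + srsGamma N n ^ 2 * ((n : ℝ) - 1) ^ 2 + srsEta N n ^ 2) ≤
      √ρ * √(f * (1 - f) / 4 + (n : ℝ) ^ 2 * powerSum a 6 + 2 * (f / (1 - f)) ^ 2) := by
    rw [← Real.sqrt_mul hρ0, ← Real.sqrt_sq hn0.le, ← Real.sqrt_mul (by positivity),
      Real.sqrt_sq hn0.le]
    apply Real.sqrt_le_sqrt
    have e : (n : ℝ) ^ 2 * (srsSigma n a ^ 2 / (4 * (n : ℝ) ^ 2) + powerSum a 6 * srsAlpha N n ^ 2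
      + srsBeta N n ^ 2 + srsGamma N n ^ 2 * ((n : ℝ) - 1) ^ 2 + srsEta N n ^ 2) =
      srsSigma n a ^ 2 / 4 + (n ^ 2 * powerSum a 6) * srsAlpha N n ^ 2 +
      ((n * srsBeta N n) ^ 2 + (n * (srsGamma N n * (n - 1))) ^ 2 + (n * srsEta N n) ^ 2) := by
      field_simp
      ring
    rw [e]
    have := mul_le_mul_of_nonneg_left r2 (by positivity : 0 ≤ (n : ℝ) ^ 2 * powerSum a 6)
    linarith
  have hv : 0 < √(f * (1 - f)) := Real.sqrt_pos.2 (by positivity)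
  have := mul_le_mul_of_nonneg_left key (by positivity : 0 ≤ √8 / (3 * srsSigma n a))
  refine (le_of_eq ?_).trans (this.trans (le_of_eq ?_))
  · rw [srsC1]
    ring
  · rw [srsB1, srsRatio₁, hσs, ← hρ]
    field_simp

theorem mul_srsC2_le {N n : ℕ} (hn : 0 < n) (hN : n < N) {f : ℝ} (hf0 : 0 < f) (hf1 : f < 1)
    {a : Fin N → ℝ} (ha : IsAdmissiblePopulation a) :
    n * (1 / (8 * srsSigma n a ^ 2) * srsC2 a) ≤ srsB2 f n a * srsRatio₂ f N n := by
  have hσ := srsSigma_pos hn hN ha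
  have hf : 1 - f ≠ 0 := (sub_pos.2 hf1).ne'
  have hp := powerSum_nonneg a (k := 4) (by decide)
  have hN0 : (0 : ℝ) < N := by exact_mod_cast hn.trans hN
  have key : 11 * n * powerSum a 4 + 45 * (n / N) ≤
      max 1 (n / N / f : ℝ) * (11 * n * powerSum a 4 + 45 * f) := by
    have h1 := mul_le_mul_of_nonneg_right (le_max_left 1 (n / N / f : ℝ))
      (by positivity : 0 ≤ 11 * n * powerSum a 4)
    have h2 : (n / N : ℝ) ≤ max 1 (n / N / f : ℝ) * f := by
      rw [← div_le_iff₀ hf0]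
      exact le_max_right _ _
    linarith
  have := mul_le_mul_of_nonneg_left key (by positivity : 0 ≤ 1 / (8 * srsSigma n a ^ 2))
  refine (le_of_eq ?_).trans (this.trans (le_of_eq ?_))
  · rw [srsC2]
    ring
  · rw [srsB2, srsRatio₂, ← srsSigma_sq hn hN ha]
    field_simp

variable {N n : ℕ → ℕ} {f : ℝ}

/-- Quantities rational in `N` and `n` become functions of `n/N` and `1/N`, continuous at `(f, 0)`.
The bounds on `x` and `y` keep the denominators away from zero. -/
theorem tendsto_of_sampling_fraction (hnN : ∀ k, 0 < n k ∧ n k < N k)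
    (hn : Tendsto n atTop atTop)
    (hu : Tendsto (fun k => (n k : ℝ) / (N k : ℝ)) atTop (𝓝 f)) {F : ℝ → ℝ → ℝ} {G : ℝ × ℝ → ℝ}
    (hG : ContinuousAt G (f, 0))
    (hFG : ∀ x y : ℝ, 1 ≤ x → x + 1 ≤ y → F y x = G (x / y, 1 / y)) :
    Tendsto (fun k => F (N k) (n k)) atTop (𝓝 (G (f, 0))) := by
  have hN : Tendsto (fun k => (N k : ℝ)) atTop atTop :=
    tendsto_natCast_atTop_atTop.comp (tendsto_atTop_mono (fun k => (hnN k).2.le) hn)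
  have he : Tendsto (fun k => 1 / (N k : ℝ)) atTop (𝓝 0) := hN.const_div_atTop 1
  refine (hG.tendsto.comp (hu.prodMk_nhds he)).congr fun k => ?_
  refine (hFG _ _ ?_ ?_).symm
  · exact_mod_cast (hnN k).1
  · exact_mod_cast (hnN k).2

theorem tendsto_srsVariance (hnN : ∀ k, 0 < n k ∧ n k < N k)
    (hn : Tendsto n atTop atTop)
    (hu : Tendsto (fun k => (n k : ℝ) / (N k : ℝ)) atTop (𝓝 f)) :
    Tendsto (fun k => (n k * (N k - n k) / (N k * (N k - 1)) : ℝ)) atTop (𝓝 (f * (1 - f))) := by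
  have := tendsto_of_sampling_fraction hnN hn hu
    (F := fun y x => x * (y - x) / (y * (y - 1)))
    (G := fun p => p.1 * (1 - p.1) / (1 - p.2))
    (by fun_prop (disch := norm_num)) (fun x y hx hy => by
      have : y ≠ 0 := by linarith
      have : y - 1 ≠ 0 := by linarith
      field_simp)
  simpa using this

theorem tendsto_srsSummandRatio (hf0 : 0 < f) (hf1 : f < 1) (hnN : ∀ k, 0 < n k ∧ n k < N k)
    (hn : Tendsto n atTop atTop)
    (hu : Tendsto (fun k => (n k : ℝ) / (N k : ℝ)) atTop (𝓝 f)) :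
    Tendsto (fun k => srsSummandRatio f (N k) (n k)) atTop (𝓝 1) := by
  have hf : 1 - f ≠ 0 := by linarith
  have l1 := (tendsto_srsVariance hnN hn hu).div_const (f * (1 - f))
  rw [div_self (by positivity)] at l1
  have l2 := tendsto_of_sampling_fraction hnN hn hu (F := fun y x => srsAlpha y x)
    (G := fun p => (p.1 - p.2) * p.2 / (1 - p.1) - 1)
    (by fun_prop (disch := simpa using hf)) (fun x y hx hy => by
      have : y ≠ 0 := by linarith
      have : y - x ≠ 0 := by linarith
      simp only [srsAlpha]
      field_simp)
  have l3 := tendsto_of_sampling_fraction hnN hn hu (F := fun y x => x * srsBeta y x)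
    (G := fun p => -2 * p.1 * (p.1 - p.2) / (1 - p.1 + p.2) + p.1 * (p.1 - 3 * p.2) / (1 - p.1)
      - p.1)
    (by fun_prop (disch := simpa using hf)) (fun x y hx hy => by
      have : y ≠ 0 := by linarith
      have : y - x ≠ 0 := by linarith
      have : y - x + 1 ≠ 0 := by linarith
      simp only [srsBeta]
      field_simp)
  have l4 := tendsto_of_sampling_fraction hnN hn hu
    (F := fun y x => x * (srsGamma y x * (x - 1)))
    (G := fun p => -2 * p.1 * (p.1 - p.2) * p.2 / ((1 - p.1) * (1 - p.1 + p.2)))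
    (by fun_prop (disch := simpa using hf)) (fun x y hx hy => by
      have : y ≠ 0 := by linarith
      have : y - x ≠ 0 := by linarith
      have : y - x + 1 ≠ 0 := by linarith
      simp only [srsGamma]
      field_simp)
  have l5 := tendsto_of_sampling_fraction hnN hn hu (F := fun y x => x * srsEta y x)
    (G := fun p => p.1 * (3 * p.2 - 1) / (1 - p.1))
    (by fun_prop (disch := simpa using hf)) (fun x y hx hy => by
      have : y ≠ 0 := by linarith
      have : y - x ≠ 0 := by linarith
      simp only [srsEta]
      field_simp
      ring)
  have l6 := (((l3.pow 2).add (l4.pow 2)).add (l5.pow 2)).div_const (2 * (f / (1 - f)) ^ 2)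
  have h := (l1.max (l2.pow 2)).max l6
  refine h.trans (le_of_eq ?_)
  congr 1
  have e1 : ((f - 0) * 0 / (1 - f) - 1) ^ 2 = 1 := by simp
  -- `n β` and `n η` both tend to `-f/(1 - f)` while the `γ` term vanishes, which explains the
  -- factor `2` in `B₁`.
  have e2 : ((-2 * f * (f - 0) / (1 - f + 0) + f * (f - 3 * 0) / (1 - f) - f) ^ 2 +
      (-2 * f * (f - 0) * 0 / ((1 - f) * (1 - f + 0))) ^ 2 + (f * (3 * 0 - 1) / (1 - f)) ^ 2) /
      (2 * (f / (1 - f)) ^ 2) = 1 := by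
    simp only [sub_zero, add_zero, mul_zero, zero_div]
    field_simp
    ring
  simp only [e1, e2, max_self]

theorem tendsto_srsRatio₁ (hf0 : 0 < f) (hf1 : f < 1) (hnN : ∀ k, 0 < n k ∧ n k < N k)
    (hn : Tendsto n atTop atTop)
    (hu : Tendsto (fun k => (n k : ℝ) / (N k : ℝ)) atTop (𝓝 f)) :
    Tendsto (fun k => srsRatio₁ f (N k) (n k)) atTop (𝓝 1) := by
  have hv : 0 < √(f * (1 - f)) := Real.sqrt_pos.2 (mul_pos hf0 (sub_pos.2 hf1))
  have h := ((tendsto_srsSummandRatio hf0 hf1 hnN hn hu).sqrt.mul_const (√(f * (1 - f)))).div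
    (tendsto_srsVariance hnN hn hu).sqrt hv.ne'
  rwa [Real.sqrt_one, one_mul, div_self hv.ne'] at h

theorem tendsto_srsRatio₂ (hf0 : 0 < f) (hf1 : f < 1) (hnN : ∀ k, 0 < n k ∧ n k < N k)
    (hn : Tendsto n atTop atTop)
    (hu : Tendsto (fun k => (n k : ℝ) / (N k : ℝ)) atTop (𝓝 f)) :
    Tendsto (fun k => srsRatio₂ f (N k) (n k)) atTop (𝓝 1) := by
  have hv : 0 < f * (1 - f) := mul_pos hf0 (sub_pos.2 hf1)
  have h := (((tendsto_const_nhds (x := (1 : ℝ))).max (hu.div_const f)).mul_const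
    (f * (1 - f))).div (tendsto_srsVariance hnN hn hu) hv.ne'
  rwa [div_self hf0.ne', max_self, one_mul, div_self hv.ne'] at h

theorem normalError_srs_le_of_ratio {N n : ℕ} (hn : 0 < n) (hN : n < N) {f : ℝ} (hf0 : 0 < f)
    (hf1 : f < 1) {a : Fin N → ℝ} (ha : IsAdmissiblePopulation a) {Ω : Type*}
    [MeasurableSpace Ω] {P : Measure Ω} {X : Fin n → Ω → ℝ}
    (hX : HasLaw (fun ω i => X i ω) (srsLaw n a) P) {h : ℝ → ℝ} (hh : HasFourBoundedDerivs h) :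
    normalError P (fun ω => ∑ i, X i ω) (srsSigma n a) h ≤
      (n : ℝ)⁻¹ * (srsB1 f n a * supNorm (iteratedDeriv 3 h)
        + srsB2 f n a * supNorm (iteratedDeriv 4 h)) *
          max (srsRatio₁ f N n) (srsRatio₂ f N n) := by
  have hn0 : (0 : ℝ) < n := by exact_mod_cast hn
  set r := max (srsRatio₁ f N n) (srsRatio₂ f N n) with hr
  have h1 : n * (1 / (3 * srsSigma n a) * srsC1 n a) ≤ srsB1 f n a * r :=
    (mul_srsC1_le hn hN hf0 hf1 ha).trans
      (mul_le_mul_of_nonneg_left (le_max_left _ _) (srsB1_nonneg f n a))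
  have h2 : n * (1 / (8 * srsSigma n a ^ 2) * srsC2 a) ≤ srsB2 f n a * r :=
    (mul_srsC2_le hn hN hf0 hf1 ha).trans
      (mul_le_mul_of_nonneg_left (le_max_right _ _) (srsB2_nonneg hf0 hf1 n a))
  have h3 := mul_le_mul_of_nonneg_right h1 (supNorm_nonneg (iteratedDeriv 3 h))
  have h4 := mul_le_mul_of_nonneg_right h2 (supNorm_nonneg (iteratedDeriv 4 h))
  refine (normalError_srs_le hn hN ha hX hh).trans ?_
  rw [mul_assoc (n : ℝ)⁻¹, inv_mul_eq_div, le_div_iff₀ hn0]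
  linarith

end Asymptotics
theorem theorem4p1 :
    (∀ (N n : ℕ), 0 < n → n < N →
      ∀ (a : Fin N → ℝ), IsAdmissiblePopulation a →
      ∀ (Ω : Type*) [MeasurableSpace Ω] (P : Measure Ω) [IsProbabilityMeasure P]
        (X : Fin n → Ω → ℝ), HasLaw (fun ω i => X i ω) (srsLaw n a) P →
      ∀ h : ℝ → ℝ, HasFourBoundedDerivs h →
        normalError P (fun ω => ∑ i, X i ω) (srsSigma n a) h ≤
          1 / (3 * srsSigma n a) * srsC1 n a * supNorm (iteratedDeriv 3 h)
          + 1 / (8 * srsSigma n a ^ 2) * srsC2 a * supNorm (iteratedDeriv 4 h)) ∧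
    (∀ (N n : ℕ → ℕ) (f : ℝ), 0 < f → f < 1 → (∀ k, 0 < n k ∧ n k < N k) →
      Tendsto n atTop atTop → Tendsto (fun k => (n k : ℝ) / (N k : ℝ)) atTop (𝓝 f) →
      ∃ δ : ℕ → ℝ, Tendsto δ atTop (𝓝 0) ∧
        ∀ (k : ℕ) (a : Fin (N k) → ℝ), IsAdmissiblePopulation a →
        ∀ (Ω : Type*) [MeasurableSpace Ω] (P : Measure Ω) [IsProbabilityMeasure P]
          (X : Fin (n k) → Ω → ℝ), HasLaw (fun ω i => X i ω) (srsLaw (n k) a) P →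
        ∀ h : ℝ → ℝ, HasFourBoundedDerivs h →
          normalError P (fun ω => ∑ i, X i ω) (srsSigma (n k) a) h ≤
            (n k : ℝ)⁻¹ * (srsB1 f (n k) a * supNorm (iteratedDeriv 3 h)
              + srsB2 f (n k) a * supNorm (iteratedDeriv 4 h)) * (1 + δ k)) := by

  refine ⟨fun N n hn hN a ha Ω _ P _ X hX h hh => normalError_srs_le hn hN ha hX hh,
    -- The error term `δ` involves only `N`, `n` and `f`, hence is uniform over populations and test
    -- functions.
    fun N n f hf0 hf1 hnN hn hu => ⟨fun k =>
      max (srsRatio₁ f (N k) (n k)) (srsRatio₂ f (N k) (n k)) - 1, ?_, ?_⟩⟩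
  · have := (tendsto_srsRatio₁ hf0 hf1 hnN hn hu).max (tendsto_srsRatio₂ hf0 hf1 hnN hn hu)
    simpa using this.sub_const 1
  · intro k a ha Ω _ P _ X hX h hh
    rw [add_sub_cancel]
    exact normalError_srs_le_of_ratio (hnN k).1 (hnN k).2 hf0 hf1 ha hX hh
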